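/- Let $\Omega\subset\mathbb R^d$ be a bounded open set with $\mathcal C^1$ boundary and let $f\in\mathcal C^1(\mathbb R^d;\mathbb R^d)$ be such that for every $z\in\overline\Omega$ the solution $\Phi^t(z)$ of $\dot x=f(x)$, $x(0)=z$, exists for all $t\ge 0$ and stays in $\overline\Omega$. Let $w\colon\Omega\to\mathbb R_+$ be a measurable, almost everywhere positive weight with $w^{-1}\in W^{1,\infty}(\Omega)$. Write $X=\mathrm L^1_w(\Omega)$ with norm $\|\phi\|_X=\int_\Omega|\phi|\,w\,dx$, and identify $X^*$ with $\mathrm L^\infty_w(\Omega)=\{\varphi:\ \operatorname{ess\,sup}_\Omega|\varphi w|<\infty\}$ through the pairing $\langle\phi,\varphi\rangle_{X,X^*}=\int_\Omega\phi\,\varphi\,w^2\,dx$. Let $H=\mathrm L^2_{w^2}(\Omega)$ with $\|p\|_H^2=\int_\Omega|p|^2w^2\,dx$. Assume $f_j\in \mathrm L^\infty_w(\Omega)$ for $j=1,\dots,d$ and $\operatorname{ess\,sup}_{\Omega}\bigl(-f^\top\nabla w/w\bigr)<\infty$, where $\nabla w=-w^2\,\nabla(w^{-1})$. Let $S(t)\colon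 X\to X$, $t\ge 0$, be the preadjoint of the composition semigroup $S^*(t)\varphi=\varphi\circ\Phi^t$ on $X^*$, i.e. $\langle S(t)\phi,\varphi\rangle_{X,X^*}=\langle\phi,\varphi\circ\Phi^t\rangle_{X,X^*}$ for all $\phi\in X$, $\varphi\in X^*$. Assume that $S(t)$ is exponentially stable on $X$: there are $M$ and $\omega_0<0$ with $\|S(t)\phi\|_X\le Me^{\omega_0t}\|\phi\|_X$ for all $t\ge0$ and $\phi\in X$. Let $c_i\in \mathrm L^\infty_w(\Omega)$ for $i\in\mathbb N$, with only finitely many $c_i$ nonzero, and define the value bilinear form $$\langle\phi,\psi\rangle_P=\int_0^\infty\sum_i\langle S(t)\phi,c_i\rangle_{X,X^*}\,\langle S(t)\psi,c_i\rangle_{X,X^*}\,dt,\qquad \phi,\psi\in X .$$ Then this integral converges absolutely for all $\phi,\psi\in X$, and there is a sequence $(p_i)_{i\in\mathbb N}$ in $X^*$ with $\sum_i\|p_i\|_H^2<\infty$ and $$\langle\phi,\psi\rangle_P=\sum_i\langle\phi,p_i\rangle_{X,X^*}\,\langle\psi,p_i\rangle_{X,X^*}\qquad\text{for all }\phi,\psi\in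 X,$$ such that the following hold. 1. For every even integer $m\ge 2$ with $f_j\in W^{m-1,\infty}(\Omega)$ for all $j$ and $c_i\in W^{m,\infty}(\Omega)$ for all $i$, $$\sum_{i\ge N}\|p_i\|_H^2=\mathcal O(N^{-m})\qquad(N\to\infty).$$ 2. If $f_j,c_i\in W^{k,\infty}(\Omega)$ for all $i$, $j$ and all $k\in\mathbb N$, then $\sum_{i\ge N}\|p_i\|_H^2=\mathcal O(N^{-m})$ for every $m\in\mathbb N$, i.e. the decay is super-polynomial. -/

import Mathlib

open MeasureTheory Set Filter Asymptotics
open scoped ENNReal ContDiff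

noncomputable section

namespace KoopmanLyapunov

/-! ### Sobolev spaces and domains -/

/-- `v` is the weak partial derivative `∂ᵢ u` on the open set `Ω`, tested against `C_c^∞(Ω)`. -/
def HasWeakPartial {d : ℕ} (Ω : Set (EuclideanSpace ℝ (Fin d))) (i : Fin d)
    (u v : EuclideanSpace ℝ (Fin d) → ℝ) : Prop :=
  LocallyIntegrableOn u Ω volume ∧ LocallyIntegrableOn v Ω volume ∧
    ∀ η : EuclideanSpace ℝ (Fin d) → ℝ, ContDiff ℝ ∞ η → HasCompactSupport η → tsupport η ⊆ Ω →
      ∫ x in Ω, u x * fderiv ℝ η x (EuclideanSpace.single i 1) = - ∫ x in Ω, v x * η x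

/-- `u ∈ W^{k,∞}(Ω)`: all weak derivatives of `u` of order at most `k` exist and are essentially
bounded on `Ω`. -/
def MemSobolevInfty {d : ℕ} (Ω : Set (EuclideanSpace ℝ (Fin d))) :
    ℕ → (EuclideanSpace ℝ (Fin d) → ℝ) → Prop
  | 0, u => MemLp u ∞ (volume.restrict Ω)
  | k + 1, u => MemLp u ∞ (volume.restrict Ω) ∧
      ∀ i : Fin d, ∃ v : EuclideanSpace ℝ (Fin d) → ℝ,
        HasWeakPartial Ω i u v ∧ MemSobolevInfty Ω k v

/-- The open set `Ω` has `C¹` boundary: near each boundary point it is the sublevel set of a `C¹`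
function with nonvanishing differential at that point. (By the implicit function theorem: near each
boundary point, after a rotation, `Ω` is the region on one side of the graph of a `C¹` function.) -/
def HasC1Boundary {d : ℕ} (Ω : Set (EuclideanSpace ℝ (Fin d))) : Prop :=
  ∀ x₀ ∈ frontier Ω, ∃ (U : Set (EuclideanSpace ℝ (Fin d))) (r : EuclideanSpace ℝ (Fin d) → ℝ),
    IsOpen U ∧ x₀ ∈ U ∧ ContDiffOn ℝ 1 r U ∧ fderiv ℝ r x₀ ≠ 0 ∧ Ω ∩ U = {x ∈ U | r x < 0}

/-! ### The flow -/

/-- `x` solves `x' = f(x)` on `[0,∞)` with `x(0) = z`. -/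
def IsSolution {d : ℕ} (f : EuclideanSpace ℝ (Fin d) → EuclideanSpace ℝ (Fin d))
    (z : EuclideanSpace ℝ (Fin d)) (x : ℝ → EuclideanSpace ℝ (Fin d)) : Prop :=
  x 0 = z ∧ IsIntegralCurveOn x (fun _ => f) (Ici 0)

/-- For every initial value in the closure of `Ω` the solution exists for all times `t ≥ 0` and
stays in the closure of `Ω`. -/
def FlowInvariant {d : ℕ} (f : EuclideanSpace ℝ (Fin d) → EuclideanSpace ℝ (Fin d))
    (Ω : Set (EuclideanSpace ℝ (Fin d))) : Prop :=
  ∀ z ∈ closure Ω, ∃ x, IsSolution f z x ∧ ∀ t, 0 ≤ t → x t ∈ closure Ω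

open Classical in
/-- The solution map `Φᵗ(z)` for `t ≥ 0`; solutions are unique when `f` is `C¹`. Where there is no
global solution, the value is irrelevant. -/
def flow {d : ℕ} (f : EuclideanSpace ℝ (Fin d) → EuclideanSpace ℝ (Fin d)) (t : ℝ)
    (z : EuclideanSpace ℝ (Fin d)) : EuclideanSpace ℝ (Fin d) :=
  if h : ∃ x, IsSolution f z x then h.choose t else z

/-! ### The weighted spaces `X = L¹_w(Ω)`, `X* = L^∞_w(Ω)`, `H = L²_{w²}(Ω)` -/

/-- `φ ∈ X = L¹_w(Ω)`, i.e. `φ w ∈ L¹(Ω)`. -/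
def MemX {d : ℕ} (Ω : Set (EuclideanSpace ℝ (Fin d))) (w φ : EuclideanSpace ℝ (Fin d) → ℝ) :
    Prop :=
  IntegrableOn (fun x => φ x * w x) Ω volume

/-- The norm `∫_Ω |φ| w` of `X`. -/
def normX {d : ℕ} (Ω : Set (EuclideanSpace ℝ (Fin d))) (w φ : EuclideanSpace ℝ (Fin d) → ℝ) : ℝ :=
  ∫ x in Ω, |φ x| * w x

/-- `ψ ∈ X* = L^∞_w(Ω)`, i.e. `ψ w ∈ L^∞(Ω)`. -/
def MemXDual {d : ℕ} (Ω : Set (EuclideanSpace ℝ (Fin d))) (w ψ : EuclideanSpace ℝ (Fin d) → ℝ) :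
    Prop :=
  MemLp (fun x => ψ x * w x) ∞ (volume.restrict Ω)

/-- The duality pairing `⟨φ, ψ⟩_{X,X*} = ∫_Ω φ ψ w²`. -/
def pairing {d : ℕ} (Ω : Set (EuclideanSpace ℝ (Fin d))) (w φ ψ : EuclideanSpace ℝ (Fin d) → ℝ) :
    ℝ :=
  ∫ x in Ω, φ x * ψ x * w x ^ 2

/-- The squared norm `‖p‖²_H = ∫_Ω |p|² w²`. -/
def normHSq {d : ℕ} (Ω : Set (EuclideanSpace ℝ (Fin d))) (w p : EuclideanSpace ℝ (Fin d) → ℝ) : ℝ :=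
  ∫ x in Ω, |p x| ^ 2 * w x ^ 2

/-! ### The standing assumptions -/

/-- The standing assumptions on the dynamics `f`, the domain `Ω` and the weight `w`. -/
structure IsAdmissible {d : ℕ} (f : EuclideanSpace ℝ (Fin d) → EuclideanSpace ℝ (Fin d))
    (Ω : Set (EuclideanSpace ℝ (Fin d))) (w : EuclideanSpace ℝ (Fin d) → ℝ) : Prop where
  isOpen : IsOpen Ω
  isBounded : Bornology.IsBounded Ω
  boundary : HasC1Boundary Ω
  dynamics : ContDiff ℝ 1 f
  invariant : FlowInvariant f Ω
  weight_measurable : AEMeasurable w (volume.restrict Ω)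
  weight_pos : ∀ᵐ x ∂(volume.restrict Ω), 0 < w x
  weight_inv : MemSobolevInfty Ω 1 (fun x => (w x)⁻¹)
  dynamics_weighted : ∀ i, MemXDual Ω w (fun x => f x i)
  /-- `ess sup_Ω (-fᵀ∇w / w) < ∞`, where `∇w = -w² ∇(w⁻¹)` is expressed through the weak gradient
  `g` of `w⁻¹`, since `w` itself may be singular. -/
  weight_decay : ∃ (ω₀ : ℝ) (g : Fin d → EuclideanSpace ℝ (Fin d) → ℝ),
    (∀ i, HasWeakPartial Ω i (fun x => (w x)⁻¹) (g i)) ∧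
      ∀ᵐ x ∂(volume.restrict Ω), -(∑ i, f x i * (-(w x ^ 2) * g i x)) / w x ≤ ω₀

/-! ### The semigroups and the value bilinear form -/

/-- The composition semigroup `S*(t) ψ = ψ ∘ Φᵗ`. -/
def compositionSemigroup {d : ℕ} (f : EuclideanSpace ℝ (Fin d) → EuclideanSpace ℝ (Fin d)) (t : ℝ)
    (ψ : EuclideanSpace ℝ (Fin d) → ℝ) : EuclideanSpace ℝ (Fin d) → ℝ :=
  fun z => ψ (flow f t z)

/-- `ρ = S(t) φ`: `ρ ∈ X` represents `ψ ↦ ⟨φ, S*(t) ψ⟩_{X,X*}`. This determines `ρ` up to null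
sets. -/
def IsPreadjointValue {d : ℕ} (f : EuclideanSpace ℝ (Fin d) → EuclideanSpace ℝ (Fin d))
    (Ω : Set (EuclideanSpace ℝ (Fin d))) (w : EuclideanSpace ℝ (Fin d) → ℝ) (t : ℝ)
    (φ ρ : EuclideanSpace ℝ (Fin d) → ℝ) : Prop :=
  MemX Ω w ρ ∧ ∀ ψ, MemXDual Ω w ψ →
    pairing Ω w ρ ψ = pairing Ω w φ (compositionSemigroup f t ψ)

open Classical in
/-- The preadjoint `S(t) : X → X` of the composition semigroup. -/
def preadjoint {d : ℕ} (f : EuclideanSpace ℝ (Fin d) → EuclideanSpace ℝ (Fin d))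
    (Ω : Set (EuclideanSpace ℝ (Fin d))) (w : EuclideanSpace ℝ (Fin d) → ℝ) (t : ℝ)
    (φ : EuclideanSpace ℝ (Fin d) → ℝ) : EuclideanSpace ℝ (Fin d) → ℝ :=
  if h : ∃ ρ, IsPreadjointValue f Ω w t φ ρ then h.choose else 0

/-- `S(t)` is exponentially stable over `X`: `‖S(t)φ‖_X ≤ M e^{ω₀ t} ‖φ‖_X` for some `ω₀ < 0`. -/
def ExponentiallyStable {d : ℕ} (f : EuclideanSpace ℝ (Fin d) → EuclideanSpace ℝ (Fin d))
    (Ω : Set (EuclideanSpace ℝ (Fin d))) (w : EuclideanSpace ℝ (Fin d) → ℝ) : Prop :=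
  ∃ M ω₀ : ℝ, ω₀ < 0 ∧ ∀ t, 0 ≤ t → ∀ φ, MemX Ω w φ →
    normX Ω w (preadjoint f Ω w t φ) ≤ M * Real.exp (ω₀ * t) * normX Ω w φ

/-- The observation operator `C φ = (⟨φ, cᵢ⟩_{X,X*})ᵢ`. -/
def observation {d : ℕ} (Ω : Set (EuclideanSpace ℝ (Fin d))) (w : EuclideanSpace ℝ (Fin d) → ℝ)
    (c : ℕ → EuclideanSpace ℝ (Fin d) → ℝ) (φ : EuclideanSpace ℝ (Fin d) → ℝ) : ℕ → ℝ :=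
  fun i => pairing Ω w φ (c i)

/-- The integrand `t ↦ ⟨C S(t) φ, C S(t) ψ⟩_{ℓ²}` of the value bilinear form. -/
def valueIntegrand {d : ℕ} (f : EuclideanSpace ℝ (Fin d) → EuclideanSpace ℝ (Fin d))
    (Ω : Set (EuclideanSpace ℝ (Fin d))) (w : EuclideanSpace ℝ (Fin d) → ℝ)
    (c : ℕ → EuclideanSpace ℝ (Fin d) → ℝ) (φ ψ : EuclideanSpace ℝ (Fin d) → ℝ) (t : ℝ) : ℝ :=
  ∑' i, observation Ω w c (preadjoint f Ω w t φ) i * observation Ω w c (preadjoint f Ω w t ψ) i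

/-- The value bilinear form `⟨φ, ψ⟩_P = ∫₀^∞ ⟨C S(t) φ, C S(t) ψ⟩_{ℓ²} dt`. -/
def valueForm {d : ℕ} (f : EuclideanSpace ℝ (Fin d) → EuclideanSpace ℝ (Fin d))
    (Ω : Set (EuclideanSpace ℝ (Fin d))) (w : EuclideanSpace ℝ (Fin d) → ℝ)
    (c : ℕ → EuclideanSpace ℝ (Fin d) → ℝ) (φ ψ : EuclideanSpace ℝ (Fin d) → ℝ) : ℝ :=
  ∫ t in Ioi (0 : ℝ), valueIntegrand f Ω w c φ ψ t

/-- The tail `∑_{i ≥ N} ‖pᵢ‖²_H`. -/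
def tail {d : ℕ} (Ω : Set (EuclideanSpace ℝ (Fin d))) (w : EuclideanSpace ℝ (Fin d) → ℝ)
    (p : ℕ → EuclideanSpace ℝ (Fin d) → ℝ) (N : ℕ) : ℝ :=
  ∑' i, normHSq Ω w (p (N + i))

end KoopmanLyapunov

end

namespace KoopmanLyapunov

open scoped NNReal Topology Polynomial

/-! ### Uniqueness and two-sided Gronwall bounds for integral curves -/

section ODE

variable {E : Type*} [NormedAddCommGroup E] [NormedSpace ℝ E] {f : E → E} {S : Set E} {K : ℝ≥0}
  {x y : ℝ → E} {a b : ℝ}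

/-! The value form is factored by expanding in time. By duality `⟨S(t)φ, cᵢ⟩ = ⟨φ, cᵢ ∘ Φᵗ⟩`, so the
form is a finite sum of `L²(0,∞)` inner products of the functions `t ↦ ⟨φ, cᵢ ∘ Φᵗ⟩`. Let `ℓₙ` be
the orthonormal Laguerre functions and put `pₙᵢ(x) = ∫₀^∞ cᵢ(Φᵗ(x)) ℓₙ(t) dt` (`laguerreFactor`).
Fubini moves the pairing with `φ` inside this integral, and Parseval gives the factorization
(`hasSum_pairing_laguerreFactor`).

Everything converges because exponential stability is equivalent to a pointwise bound in disguise: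
testing `S(t)` on `1_s w⁻¹` against `w⁻¹` yields `w(Φᵗ(x))⁻¹ ≤ M e^{-δt} w(x)⁻¹` almost everywhere
(`exists_inv_weight_flow_le`). Hence every observable in `X*` decays like `e^{-δt} w(x)⁻¹` along
almost every trajectory.

The rate comes from the operator `Au = t u / 4 - (t u')'`, for which `Aℓₙ = (n + 1/2) ℓₙ`. Moving
`A^q` from `ℓₙ` to `t ↦ cᵢ(Φᵗ(x))` uses `2q` derivatives along the flow; the factor `t` kills the
boundary terms at `0`, and the decay kills those at infinity. Bessel's inequality bounds `∑ₙ (n +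
1/2)^{2q} pₙᵢ(x)²` by a multiple of `w(x)⁻²` (`exists_ae_sum_sq_laguerreFactor_le`), and integration
against `w²` over the bounded set `Ω` gives the tail rate with `m = 2q`. This is why `m` is even.

The derivatives along the flow are the iterates of `f · ∇`, taken in the weak sense. The chain rule
along trajectories is proved by mollification (`hasFlowDerivative_of_hasWeakPartial`). It needs
trajectories to stay in the open set `Ω` (`flow_mem`) and preimages of null sets under `Φᵗ` to be
null (`ae_flow`). -/

lemma dist_le_of_integralCurves (hK : LipschitzOnWith K f S)
    (hx : IsIntegralCurveOn x (fun _ => f) (Icc a b)) (hxS : ∀ t ∈ Icc a b, x t ∈ S)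
    (hy : IsIntegralCurveOn y (fun _ => f) (Icc a b)) (hyS : ∀ t ∈ Icc a b, y t ∈ S)
    {t : ℝ} (ht : t ∈ Icc a b) :
    dist (x t) (y t) ≤ dist (x a) (y a) * Real.exp (K * (t - a)) := by
  refine dist_le_of_trajectories_ODE_of_mem (v := fun _ => f) (s := fun _ => S) (fun _ _ => hK)
    (fun t ht => (hx t ht).continuousWithinAt) (fun t ht => ?_)
    (fun t ht => hxS t (Ico_subset_Icc_self ht))
    (fun t ht => (hy t ht).continuousWithinAt) (fun t ht => ?_)
    (fun t ht => hyS t (Ico_subset_Icc_self ht)) le_rfl t ht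
  · exact (hx t (Ico_subset_Icc_self ht)).mono_of_mem_nhdsWithin (Icc_mem_nhdsGE_of_mem ht)
  · exact (hy t (Ico_subset_Icc_self ht)).mono_of_mem_nhdsWithin (Icc_mem_nhdsGE_of_mem ht)

lemma IsIntegralCurveOn.reverse (hx : IsIntegralCurveOn x (fun _ => f) (Icc a b)) :
    IsIntegralCurveOn (fun t => x (-t)) (fun _ z => -f z) (Icc (-b) (-a)) := by
  intro t ht
  have ht' : -t ∈ Icc a b := ⟨by linarith [ht.2], by linarith [ht.1]⟩
  have h := (hx (-t) ht').scomp t (hasDerivWithinAt_neg t (Icc (-b) (-a)))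
    (fun s hs => ⟨by linarith [hs.2], by linarith [hs.1]⟩)
  simpa [Function.comp_def] using h

/-- The forward estimate for the time-reversed curves, which solve the equation with `-f`. It later
supplies a Lipschitz inverse of `Φᵗ`. -/
lemma dist_le_of_integralCurves_left (hK : LipschitzOnWith K f S)
    (hx : IsIntegralCurveOn x (fun _ => f) (Icc a b)) (hxS : ∀ t ∈ Icc a b, x t ∈ S)
    (hy : IsIntegralCurveOn y (fun _ => f) (Icc a b)) (hyS : ∀ t ∈ Icc a b, y t ∈ S)
    {t : ℝ} (ht : t ∈ Icc a b) :
    dist (x t) (y t) ≤ dist (x b) (y b) * Real.exp (K * (b - t)) := by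
  have hK' : LipschitzOnWith K (fun z => -f z) S := by
    intro p hp q hq
    simpa [edist_neg_neg] using hK hp hq
  have hm : ∀ s ∈ Icc (-b) (-a), -s ∈ Icc a b := fun s hs =>
    ⟨by linarith [hs.2], by linarith [hs.1]⟩
  have h := dist_le_of_integralCurves hK' (IsIntegralCurveOn.reverse hx)
    (fun s hs => hxS _ (hm s hs)) (IsIntegralCurveOn.reverse hy) (fun s hs => hyS _ (hm s hs))
    (t := -t) ⟨by linarith [ht.2], by linarith [ht.1]⟩
  simpa [sub_eq_add_neg, add_comm] using h

variable [FiniteDimensional ℝ E]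

lemma exists_lipschitzOnWith_of_isBounded (hf : ContDiff ℝ 1 f) (hS : Bornology.IsBounded S) :
    ∃ K : ℝ≥0, LipschitzOnWith K f S := by
  obtain ⟨R, hR⟩ := hS.subset_closedBall 0
  obtain ⟨K, hK⟩ := hf.contDiffOn.exists_lipschitzOnWith one_ne_zero
    (convex_closedBall (0 : E) R) (isCompact_closedBall 0 R)
  exact ⟨K, hK.mono hR⟩

/-- A `C¹` field is Lipschitz only on bounded sets; two curves over a compact time interval have
bounded image, which suffices for uniqueness. -/
lemma exists_lipschitzOnWith_of_integralCurves (hf : ContDiff ℝ 1 f)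
    (hx : IsIntegralCurveOn x (fun _ => f) (Icc a b))
    (hy : IsIntegralCurveOn y (fun _ => f) (Icc a b)) :
    ∃ K : ℝ≥0, LipschitzOnWith K f (x '' Icc a b ∪ y '' Icc a b) := by
  refine exists_lipschitzOnWith_of_isBounded hf (Bornology.IsBounded.union ?_ ?_)
  · exact (isCompact_Icc.image_of_continuousOn fun t ht => (hx t ht).continuousWithinAt).isBounded
  · exact (isCompact_Icc.image_of_continuousOn fun t ht => (hy t ht).continuousWithinAt).isBounded

lemma integralCurves_eqOn (hf : ContDiff ℝ 1 f)
    (hx : IsIntegralCurveOn x (fun _ => f) (Icc a b))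
    (hy : IsIntegralCurveOn y (fun _ => f) (Icc a b)) (h : x a = y a) :
    EqOn x y (Icc a b) := by
  intro t ht
  obtain ⟨K, hK⟩ := exists_lipschitzOnWith_of_integralCurves hf hx hy
  have := dist_le_of_integralCurves hK hx (fun t ht => Or.inl ⟨t, ht, rfl⟩) hy
    (fun t ht => Or.inr ⟨t, ht, rfl⟩) ht
  rw [h, dist_self, zero_mul] at this
  exact dist_le_zero.1 this

lemma integralCurves_eqOn_left (hf : ContDiff ℝ 1 f)
    (hx : IsIntegralCurveOn x (fun _ => f) (Icc a b))
    (hy : IsIntegralCurveOn y (fun _ => f) (Icc a b)) (h : x b = y b) :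
    EqOn x y (Icc a b) := by
  intro t ht
  obtain ⟨K, hK⟩ := exists_lipschitzOnWith_of_integralCurves hf hx hy
  have := dist_le_of_integralCurves_left hK hx (fun t ht => Or.inl ⟨t, ht, rfl⟩) hy
    (fun t ht => Or.inr ⟨t, ht, rfl⟩) ht
  rw [h, dist_self, zero_mul] at this
  exact dist_le_zero.1 this

end ODE

/-! ### The flow: invariance of the open set, continuity, nonsingularity -/

section Flow

variable {d : ℕ} {f : EuclideanSpace ℝ (Fin d) → EuclideanSpace ℝ (Fin d)}
  {Ω : Set (EuclideanSpace ℝ (Fin d))} {x y z : EuclideanSpace ℝ (Fin d)} {t : ℝ}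

/-- `flow` picks some solution by choice, while `FlowInvariant` speaks of a possibly different one;
uniqueness identifies them and transfers the invariance. -/
lemma isSolution_flow (hf : ContDiff ℝ 1 f) (hinv : FlowInvariant f Ω) (hz : z ∈ closure Ω) :
    IsSolution f z (fun t => flow f t z) ∧ ∀ t, 0 ≤ t → flow f t z ∈ closure Ω := by
  obtain ⟨u, hu, huΩ⟩ := hinv z hz
  have h : ∃ u, IsSolution f z u := ⟨u, hu⟩
  have hfl : (fun t => flow f t z) = h.choose := by
    funext t
    simp only [flow, dif_pos h]
  have hs : IsSolution f z (fun t => flow f t z) := by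
    rw [hfl]
    exact h.choose_spec
  refine ⟨hs, fun t ht => ?_⟩
  have heq := integralCurves_eqOn hf (IsIntegralCurveOn.mono hs.2 Icc_subset_Ici_self)
    (IsIntegralCurveOn.mono hu.2 (Icc_subset_Ici_self (a := t) (b := 0)))
    (show (fun t => flow f t z) 0 = u 0 by rw [hu.1]; exact hs.1)
  have := heq (right_mem_Icc.2 ht)
  simp only at this
  rw [this]
  exact huΩ t ht

lemma flow_zero (hf : ContDiff ℝ 1 f) (hinv : FlowInvariant f Ω) (hz : z ∈ closure Ω) :
    flow f 0 z = z := (isSolution_flow hf hinv hz).1.1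

lemma flow_mem_closure (hf : ContDiff ℝ 1 f) (hinv : FlowInvariant f Ω) (hz : z ∈ closure Ω)
    (ht : 0 ≤ t) : flow f t z ∈ closure Ω := (isSolution_flow hf hinv hz).2 t ht

lemma isIntegralCurveOn_flow (hf : ContDiff ℝ 1 f) (hinv : FlowInvariant f Ω)
    (hz : z ∈ closure Ω) : IsIntegralCurveOn (fun t => flow f t z) (fun _ => f) (Ici 0) :=
  (isSolution_flow hf hinv hz).1.2

/-- Gronwall forwards and backwards in time: `Φᵗ` is bi-Lipschitz onto its image, with one constant
`K` for all times. -/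
lemma exists_dist_flow_le (hf : ContDiff ℝ 1 f) (hb : Bornology.IsBounded Ω)
    (hinv : FlowInvariant f Ω) :
    ∃ K : ℝ≥0, ∀ t, 0 ≤ t → ∀ x ∈ closure Ω, ∀ y ∈ closure Ω,
      dist (flow f t x) (flow f t y) ≤ dist x y * Real.exp (K * t) ∧
      dist x y ≤ dist (flow f t x) (flow f t y) * Real.exp (K * t) := by
  obtain ⟨K, hK⟩ := exists_lipschitzOnWith_of_isBounded hf hb.closure
  refine ⟨K, fun t ht x hx y hy => ?_⟩
  have h (z) (hz : z ∈ closure Ω) :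
      IsIntegralCurveOn (fun t => flow f t z) (fun _ => f) (Icc 0 t) :=
    IsIntegralCurveOn.mono (isIntegralCurveOn_flow hf hinv hz) Icc_subset_Ici_self
  have h' (z) (hz : z ∈ closure Ω) : ∀ s ∈ Icc 0 t, flow f s z ∈ closure Ω :=
    fun s hs => flow_mem_closure hf hinv hz hs.1
  constructor
  · simpa [flow_zero hf hinv hx, flow_zero hf hinv hy] using
      dist_le_of_integralCurves hK (h x hx) (h' x hx) (h y hy) (h' y hy) (right_mem_Icc.2 ht)
  · simpa [flow_zero hf hinv hx, flow_zero hf hinv hy] using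
      dist_le_of_integralCurves_left hK (h x hx) (h' x hx) (h y hy) (h' y hy) (left_mem_Icc.2 ht)

lemma continuousOn_flow_time (hf : ContDiff ℝ 1 f) (hinv : FlowInvariant f Ω)
    (hz : z ∈ closure Ω) : ContinuousOn (fun t => flow f t z) (Ici 0) :=
  fun t ht => (isIntegralCurveOn_flow hf hinv hz t ht).continuousWithinAt

lemma continuousOn_flow (hf : ContDiff ℝ 1 f) (hb : Bornology.IsBounded Ω)
    (hinv : FlowInvariant f Ω) :
    ContinuousOn (fun p : EuclideanSpace ℝ (Fin d) × ℝ => flow f p.2 p.1)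
      (closure Ω ×ˢ Ici 0) := by
  obtain ⟨K, hK⟩ := exists_dist_flow_le hf hb hinv
  rintro ⟨x₀, t₀⟩ ⟨hx₀, ht₀⟩
  have h1 : Tendsto (fun p : EuclideanSpace ℝ (Fin d) × ℝ =>
      dist p.1 x₀ * Real.exp (K * p.2) + dist (flow f p.2 x₀) (flow f t₀ x₀))
      (𝓝[closure Ω ×ˢ Ici 0] (x₀, t₀)) (𝓝 0) := by
    have ha : Tendsto (fun p : EuclideanSpace ℝ (Fin d) × ℝ => dist p.1 x₀ * Real.exp (K * p.2))
        (𝓝[closure Ω ×ˢ Ici 0] (x₀, t₀)) (𝓝 (dist x₀ x₀ * Real.exp (K * t₀))) := by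
      apply Tendsto.mono_left _ nhdsWithin_le_nhds
      have hc : Continuous (fun p : EuclideanSpace ℝ (Fin d) × ℝ =>
          dist p.1 x₀ * Real.exp (K * p.2)) := by fun_prop
      exact hc.tendsto (x₀, t₀)
    have hb : Tendsto (fun p : EuclideanSpace ℝ (Fin d) × ℝ =>
        dist (flow f p.2 x₀) (flow f t₀ x₀)) (𝓝[closure Ω ×ˢ Ici 0] (x₀, t₀)) (𝓝 0) := by
      rw [← tendsto_iff_dist_tendsto_zero]
      refine (continuousOn_flow_time hf hinv hx₀ t₀ ht₀).tendsto.comp ?_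
      rw [nhdsWithin_prod_eq]
      exact tendsto_snd
    simpa using ha.add hb
  refine tendsto_iff_dist_tendsto_zero.2 (squeeze_zero' (.of_forall fun _ => dist_nonneg) ?_ h1)
  filter_upwards [self_mem_nhdsWithin] with p hp
  exact (dist_triangle _ (flow f p.2 x₀) _).trans
    (add_le_add (hK p.2 hp.2 p.1 hp.1 x₀ hx₀).1 le_rfl)

/-- At a boundary point interior to the closure, the local defining function would vanish and be
nonpositive nearby, hence have a local maximum and zero differential. The lemma excludes slits and
punctures. -/
lemma interior_closure_of_hasC1Boundary (hΩ : IsOpen Ω) (hbd : HasC1Boundary Ω) :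
    interior (closure Ω) = Ω := by
  refine subset_antisymm (fun x hx => ?_) (interior_maximal subset_closure hΩ)
  by_contra hxΩ
  have hxf : x ∈ frontier Ω := ⟨interior_subset hx, by rwa [hΩ.interior_eq]⟩
  obtain ⟨U, r, hU, hxU, hr, hr', hUr⟩ := hbd x hxf
  have hcont : ContinuousOn r U := hr.continuousOn
  have hle : ∀ y ∈ U, y ∈ closure Ω → r y ≤ 0 := by
    intro y hyU hy
    by_contra! hry
    have h1 : ∀ᶠ z in 𝓝 y, 0 < r z :=
      (hcont.continuousAt (hU.mem_nhds hyU)).eventually (lt_mem_nhds hry)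
    obtain ⟨z, hzΩ, hz, hzU⟩ :=
      ((mem_closure_iff_frequently.1 hy).and_eventually (h1.and (hU.mem_nhds hyU))).exists
    have : z ∈ {x ∈ U | r x < 0} := hUr ▸ ⟨hzΩ, hzU⟩
    exact lt_asymm hz this.2
  have hrx : r x = 0 := by
    refine le_antisymm (hle x hxU (interior_subset hx)) ?_
    by_contra! h
    have : x ∈ Ω ∩ U := hUr ▸ ⟨hxU, h⟩
    exact hxΩ this.1
  refine hr' (IsLocalMax.fderiv_eq_zero ?_)
  filter_upwards [isOpen_interior.mem_nhds hx, hU.mem_nhds hxU] with y hy hyU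
  rw [hrx]
  exact hle y hyU (interior_subset hy)

/-- If a trajectory from `Ω` first leaves it at `y`, solving backwards carries a whole neighbourhood
of `y` into `Ω`; flowing forward again keeps it in the closure. So `y` is interior to the closure,
hence lies in `Ω`. -/
lemma flow_mem (hΩ : IsOpen Ω) (hbd : HasC1Boundary Ω) (hf : ContDiff ℝ 1 f)
    (hinv : FlowInvariant f Ω) (hx : x ∈ Ω) (ht : 0 ≤ t) : flow f t x ∈ Ω := by
  by_contra hflow
  have hxc := subset_closure hx
  set S : Set ℝ := Ici 0 ∩ (fun t => flow f t x) ⁻¹' Ωᶜ with hS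
  have hSc : IsClosed S :=
    (continuousOn_flow_time hf hinv hxc).preimage_isClosed_of_isClosed isClosed_Ici
      hΩ.isClosed_compl
  have hSb : BddBelow S := ⟨0, fun s hs => hs.1⟩
  have hTS : sInf S ∈ S := hSc.csInf_mem ⟨t, ht, hflow⟩ hSb
  set T := sInf S with hT
  have hT0 : 0 < T := by
    refine lt_of_le_of_ne hTS.1 fun h => hTS.2 ?_
    simpa only [← h, flow_zero hf hinv hxc] using hx
  have hlt : ∀ s, 0 ≤ s → s < T → flow f s x ∈ Ω := by
    intro s hs hsT
    by_contra h
    exact not_lt.2 (csInf_le hSb ⟨hs, h⟩) hsT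
  set y := flow f T x with hy
  obtain ⟨ε, hε, a, r, L, K, hr, hPL⟩ :=
    IsPicardLindelof.of_contDiffAt_one (hf.contDiffAt (x := y))
  obtain ⟨α, hα, hαc⟩ := (hPL T).exists_forall_mem_closedBall_eq_hasDerivWithinAt_continuousOn
  -- An earlier time that is nonnegative, strictly before `T`, and inside the interval where the
  -- local flow `α` based at time `T` exists.
  set s := max (T - ε) (T / 2) with hs
  have hsT : s < T := max_lt (by linarith) (by linarith)
  have hs0 : 0 ≤ s := le_trans (by linarith) (le_max_right _ _)
  have hsub : Icc s T ⊆ Icc (T - ε) (T + ε) :=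
    Icc_subset_Icc (le_max_left _ _) (by linarith)
  have hyb : y ∈ Metric.closedBall y r := Metric.mem_closedBall_self r.2
  have hcurve : ∀ y' ∈ Metric.closedBall y r,
      IsIntegralCurveOn (fun t => α (y', t)) (fun _ => f) (Icc s T) :=
    fun y' hy' t ht => ((hα y' hy').2 t (hsub ht)).mono hsub
  have hys : α (y, s) = flow f s x :=
    integralCurves_eqOn_left hf (hcurve y hyb)
      (IsIntegralCurveOn.mono (isIntegralCurveOn_flow hf hinv hxc)
        (fun u hu => hs0.trans hu.1)) (hα y hyb).1 (left_mem_Icc.2 hsT.le)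
  have hnear : ∀ᶠ y' in 𝓝 y, α (y', s) ∈ Ω := by
    have hc : ContinuousOn (fun y' => α (y', s)) (Metric.closedBall y r) :=
      hαc.comp (by fun_prop) fun y' hy' => ⟨hy', hsub (left_mem_Icc.2 hsT.le)⟩
    refine (hc.continuousAt (Metric.closedBall_mem_nhds y hr)).eventually (hΩ.mem_nhds ?_)
    exact (congrArg (· ∈ Ω) hys).mpr (hlt s hs0 hsT)
  have hint : y ∈ interior (closure Ω) := by
    rw [mem_interior_iff_mem_nhds]
    filter_upwards [hnear, Metric.closedBall_mem_nhds y hr] with y' hy' hy'b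
    have hz := subset_closure hy'
    have hcur2 : IsIntegralCurveOn (fun t => flow f (t - s) (α (y', s))) (fun _ => f)
        (Icc s T) := by
      intro u hu
      have h := (isIntegralCurveOn_flow hf hinv hz (u - s) (sub_nonneg.2 hu.1)).scomp u
        ((hasDerivWithinAt_id u (Icc s T)).sub_const s) (fun v hv => sub_nonneg.2 hv.1)
      simpa [Function.comp_def] using h
    have := integralCurves_eqOn hf (hcurve y' hy'b) hcur2
      (by simp [flow_zero hf hinv hz]) (right_mem_Icc.2 hsT.le)
    simp only [(hα y' hy'b).1] at this
    rw [this]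
    exact flow_mem_closure hf hinv hz (by linarith)
  rw [interior_closure_of_hasC1Boundary hΩ hbd] at hint
  exact hTS.2 hint

/-- Lipschitz maps enlarge Hausdorff measure by at most a constant, and in top dimension Hausdorff
and Lebesgue measure have the same null sets. -/
lemma volume_image_eq_zero_of_lipschitzOnWith {K : ℝ≥0}
    {g : EuclideanSpace ℝ (Fin d) → EuclideanSpace ℝ (Fin d)} {N : Set (EuclideanSpace ℝ (Fin d))}
    (hg : LipschitzOnWith K g N) (hN : volume N = 0) : volume (g '' N) = 0 := by
  set n := Module.finrank ℝ (EuclideanSpace ℝ (Fin d))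
  have h1 : (Measure.hausdorffMeasure n : Measure (EuclideanSpace ℝ (Fin d))) N = 0 :=
    Measure.absolutelyContinuous_isAddHaarMeasure _ volume hN
  refine Measure.absolutelyContinuous_isAddHaarMeasure volume
    (Measure.hausdorffMeasure n : Measure (EuclideanSpace ℝ (Fin d))) ?_
  refine le_antisymm ((hg.hausdorffMeasure_image_le n.cast_nonneg).trans ?_) zero_le
  simp [h1]

/-- The preimage is the image of a null set under the Lipschitz inverse of `Φᵗ`. No Jacobian of the
flow is needed. -/
lemma volume_preimage_flow_eq_zero (hf : ContDiff ℝ 1 f) (hb : Bornology.IsBounded Ω)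
    (hinv : FlowInvariant f Ω) (ht : 0 ≤ t) {N : Set (EuclideanSpace ℝ (Fin d))}
    (hN : volume N = 0) : volume (Ω ∩ flow f t ⁻¹' N) = 0 := by
  obtain ⟨K, hK⟩ := exists_dist_flow_le hf hb hinv
  set A := Ω ∩ flow f t ⁻¹' N
  have hA : ∀ x ∈ A, x ∈ closure Ω := fun x hx => subset_closure hx.1
  have hinj : InjOn (flow f t) A := by
    intro x hx y hy hxy
    have := (hK t ht x (hA x hx) y (hA y hy)).2
    rw [hxy, dist_self, zero_mul] at this
    exact dist_le_zero.1 this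
  have hinvOn := hinj.leftInvOn_invFunOn
  have hlip : LipschitzOnWith (Real.exp (K * t)).toNNReal
      (Function.invFunOn (flow f t) A) (flow f t '' A) := by
    refine LipschitzOnWith.of_dist_le_mul ?_
    rintro _ ⟨x, hx, rfl⟩ _ ⟨y, hy, rfl⟩
    rw [hinvOn hx, hinvOn hy, Real.coe_toNNReal _ (Real.exp_pos _).le, mul_comm]
    exact (hK t ht x (hA x hx) y (hA y hy)).2
  have h := volume_image_eq_zero_of_lipschitzOnWith hlip
    (measure_mono_null (image_subset_iff.2 fun x hx => hx.2) hN)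
  rwa [hinvOn.image_image] at h

lemma ae_flow (hΩ : IsOpen Ω) (hbd : HasC1Boundary Ω) (hf : ContDiff ℝ 1 f)
    (hb : Bornology.IsBounded Ω) (hinv : FlowInvariant f Ω)
    {P : EuclideanSpace ℝ (Fin d) → Prop} (hP : ∀ᵐ y ∂volume.restrict Ω, P y) (ht : 0 ≤ t) :
    ∀ᵐ x ∂volume.restrict Ω, P (flow f t x) := by
  rw [ae_restrict_iff' hΩ.measurableSet] at hP ⊢
  have h := volume_preimage_flow_eq_zero hf hb hinv ht (ae_iff.1 hP)
  filter_upwards [measure_eq_zero_iff_ae_notMem.1 h] with x hx hxΩ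
  by_contra hPx
  exact hx ⟨hxΩ, fun h => hPx (h (flow_mem hΩ hbd hf hinv hxΩ ht))⟩

lemma aemeasurable_flow (hΩ : IsOpen Ω) (hf : ContDiff ℝ 1 f)
    (hb : Bornology.IsBounded Ω) (hinv : FlowInvariant f Ω) (ht : 0 ≤ t) :
    AEMeasurable (flow f t) (volume.restrict Ω) := by
  have h : ContinuousOn (flow f t) Ω :=
    (continuousOn_flow hf hb hinv).comp (f := fun x => (x, t)) (by fun_prop)
      fun x hx => ⟨subset_closure hx, ht⟩
  exact h.aemeasurable hΩ.measurableSet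

lemma map_flow_absolutelyContinuous (hΩ : IsOpen Ω) (hbd : HasC1Boundary Ω) (hf : ContDiff ℝ 1 f)
    (hb : Bornology.IsBounded Ω) (hinv : FlowInvariant f Ω) (ht : 0 ≤ t) :
    (volume.restrict Ω).map (flow f t) ≪ volume.restrict Ω := by
  refine Measure.AbsolutelyContinuous.mk fun s hs h => ?_
  rw [Measure.map_apply_of_aemeasurable (aemeasurable_flow hΩ hf hb hinv ht) hs]
  exact measure_eq_zero_iff_ae_notMem.2
    (ae_flow hΩ hbd hf hb hinv (measure_eq_zero_iff_ae_notMem.1 h) ht)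

lemma aemeasurable_flow_prod (hΩ : IsOpen Ω) (hf : ContDiff ℝ 1 f)
    (hb : Bornology.IsBounded Ω) (hinv : FlowInvariant f Ω) :
    AEMeasurable (fun p : EuclideanSpace ℝ (Fin d) × ℝ => flow f p.2 p.1)
      ((volume.restrict Ω).prod (volume.restrict (Ioi 0))) := by
  rw [Measure.prod_restrict]
  exact ((continuousOn_flow hf hb hinv).mono
    (prod_mono subset_closure Ioi_subset_Ici_self)).aemeasurable
    (hΩ.measurableSet.prod measurableSet_Ioi)

lemma map_flow_prod_absolutelyContinuous (hΩ : IsOpen Ω) (hbd : HasC1Boundary Ω)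
    (hf : ContDiff ℝ 1 f) (hb : Bornology.IsBounded Ω) (hinv : FlowInvariant f Ω) :
    ((volume.restrict Ω).prod (volume.restrict (Ioi 0))).map
      (fun p : EuclideanSpace ℝ (Fin d) × ℝ => flow f p.2 p.1) ≪ volume.restrict Ω := by
  refine Measure.AbsolutelyContinuous.mk fun s hs h => ?_
  have hm := aemeasurable_flow_prod hΩ hf hb hinv
  rw [Measure.map_apply_of_aemeasurable hm hs, ← Measure.prod_swap,
    Measure.map_apply₀ measurable_swap.aemeasurable]
  · set B := (Prod.swap ⁻¹' ((fun p : EuclideanSpace ℝ (Fin d) × ℝ => flow f p.2 p.1) ⁻¹' s))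
    -- The flow is only almost everywhere measurable, so the preimage is merely null measurable; a
    -- measurable subset of the same measure makes it accessible to Fubini, one time slice at a
    -- time.
    obtain ⟨B', hBB', hB', hBeq⟩ : ∃ B' ⊆ B, MeasurableSet B' ∧
        B' =ᵐ[(volume.restrict (Ioi (0 : ℝ))).prod (volume.restrict Ω)] B :=
      NullMeasurableSet.exists_measurable_subset_ae_eq
        ((hm.nullMeasurable hs).preimage Measure.measurePreserving_swap.quasiMeasurePreserving)
    rw [← measure_congr hBeq]
    refine Measure.measure_prod_null_of_ae_null hB' ?_
    filter_upwards [ae_restrict_mem measurableSet_Ioi] with t ht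
    refine measure_mono_null (preimage_mono hBB') ?_
    exact measure_eq_zero_iff_ae_notMem.2
      (ae_flow hΩ hbd hf hb hinv (measure_eq_zero_iff_ae_notMem.1 h) (le_of_lt ht))
  · rw [Measure.prod_swap]
    exact hm.nullMeasurable hs

/-- Fubini exchanges "for each `t`, almost every `x`" for "for almost every `x`, almost every `t`":
a typical trajectory spends zero time in a null set. -/
lemma ae_ae_flow (hΩ : IsOpen Ω) (hbd : HasC1Boundary Ω) (hf : ContDiff ℝ 1 f)
    (hb : Bornology.IsBounded Ω) (hinv : FlowInvariant f Ω)
    {P : EuclideanSpace ℝ (Fin d) → Prop} (hP : ∀ᵐ y ∂volume.restrict Ω, P y) :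
    ∀ᵐ x ∂volume.restrict Ω, ∀ᵐ t ∂volume.restrict (Ioi (0 : ℝ)), P (flow f t x) :=
  Measure.ae_ae_of_ae_prod (ae_of_ae_map (aemeasurable_flow_prod hΩ hf hb hinv)
    ((map_flow_prod_absolutelyContinuous hΩ hbd hf hb hinv).ae_le hP))

end Flow

/-! ### Mollification and weak derivatives -/

section Mollification

variable {d : ℕ} {Ω : Set (EuclideanSpace ℝ (Fin d))} {u v : EuclideanSpace ℝ (Fin d) → ℝ}
  {x y : EuclideanSpace ℝ (Fin d)} {i : Fin d}

lemma integrable_of_memLp_top (hb : Bornology.IsBounded Ω)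
    (hu : MemLp u ∞ (volume.restrict Ω)) : Integrable u (volume.restrict Ω) := by
  have : IsFiniteMeasure (volume.restrict Ω) := ⟨by simpa using hb.measure_lt_top⟩
  exact hu.integrable le_top

lemma exists_bound_of_memLp_top (hu : MemLp u ∞ (volume.restrict Ω)) :
    ∃ C, 0 ≤ C ∧ ∀ᵐ x ∂volume.restrict Ω, |u x| ≤ C :=
  ⟨(eLpNormEssSup u (volume.restrict Ω)).toReal, ENNReal.toReal_nonneg, by
    have h := ae_le_eLpNormEssSup (f := u) (μ := volume.restrict Ω)
    have h2 : eLpNormEssSup u (volume.restrict Ω) ≠ (⊤ : ℝ≥0∞) := by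
      simpa using hu.2.ne
    filter_upwards [h] with x hx
    have := ENNReal.toReal_mono h2 hx
    simpa using this⟩

lemma memLp_top_of_abs_le {C : ℝ} {μ : Measure (EuclideanSpace ℝ (Fin d))}
    (hu : AEStronglyMeasurable u μ) (h : ∀ᵐ x ∂μ, |u x| ≤ C) : MemLp u ∞ μ :=
  memLp_top_of_bound hu C h

lemma locallyIntegrable_indicator (hΩ : IsOpen Ω) (hb : Bornology.IsBounded Ω)
    (hu : MemLp u ∞ (volume.restrict Ω)) : LocallyIntegrable (Ω.indicator u) volume :=
  ((integrable_indicator_iff hΩ.measurableSet).2 (integrable_of_memLp_top hb hu)).locallyIntegrable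

/-- The mollification of the extension by zero of `u` from `Ω`. -/
noncomputable def mollify (φ : ContDiffBump (0 : EuclideanSpace ℝ (Fin d)))
    (Ω : Set (EuclideanSpace ℝ (Fin d))) (u : EuclideanSpace ℝ (Fin d) → ℝ) :
    EuclideanSpace ℝ (Fin d) → ℝ :=
  convolution (φ.normed volume) (Ω.indicator u) (ContinuousLinearMap.lsmul ℝ ℝ) volume

variable {φ : ContDiffBump (0 : EuclideanSpace ℝ (Fin d))}

lemma mollify_eq (hΩ : IsOpen Ω) :
    mollify φ Ω u y = ∫ x in Ω, φ.normed volume (y - x) * u x := by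
  rw [mollify, convolution_lsmul_swap, ← integral_indicator hΩ.measurableSet]
  congr 1
  ext x
  by_cases hx : x ∈ Ω <;> simp [hx]

lemma contDiff_mollify (hΩ : IsOpen Ω) (hb : Bornology.IsBounded Ω)
    (hu : MemLp u ∞ (volume.restrict Ω)) : ContDiff ℝ ∞ (mollify φ Ω u) :=
  HasCompactSupport.contDiff_convolution_left _ φ.hasCompactSupport_normed φ.contDiff_normed
    (locallyIntegrable_indicator hΩ hb hu)

lemma integrable_normed_sub : Integrable (fun x => φ.normed volume (y - x)) volume := by
  have : Integrable (φ.normed volume) volume :=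
    φ.continuous_normed.integrable_of_hasCompactSupport φ.hasCompactSupport_normed
  exact this.comp_sub_left y

/-- The bump has unit mass, so an essential bound becomes a bound at every point; this is what
dominates integrals along single trajectories, which are null sets when `d ≥ 2`. -/
lemma abs_mollify_le (hΩ : IsOpen Ω) {C : ℝ} (hC : 0 ≤ C)
    (hu : ∀ᵐ x ∂volume.restrict Ω, |u x| ≤ C) : |mollify φ Ω u y| ≤ C := by
  rw [mollify_eq hΩ]
  have hint := integrable_normed_sub (φ := φ) (y := y)
  calc |∫ x in Ω, φ.normed volume (y - x) * u x|
      ≤ ∫ x in Ω, C * φ.normed volume (y - x) := by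
        rw [← Real.norm_eq_abs]
        refine norm_integral_le_of_norm_le (Integrable.const_mul hint.integrableOn C) ?_
        filter_upwards [hu] with x hx
        rw [Real.norm_eq_abs, abs_mul, abs_of_nonneg (φ.nonneg_normed _), mul_comm]
        exact mul_le_mul_of_nonneg_right hx (φ.nonneg_normed _)
    _ ≤ ∫ x, C * φ.normed volume (y - x) :=
        setIntegral_le_integral (hint.const_mul C)
          (.of_forall fun x => mul_nonneg hC (φ.nonneg_normed _))
    _ = C := by
        rw [integral_const_mul, integral_sub_left_eq_self (fun x => φ.normed volume x) volume y,
          φ.integral_normed, mul_one]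

lemma fderiv_normed_sub (e : EuclideanSpace ℝ (Fin d)) :
    fderiv ℝ (fun x => φ.normed volume (y - x)) x e = -fderiv ℝ (φ.normed volume) (y - x) e := by
  have h1 : HasFDerivAt (φ.normed volume) (fderiv ℝ (φ.normed volume) (y - x)) (y - x) :=
    ((φ.contDiff_normed (n := 1)).differentiable one_ne_zero _).hasFDerivAt
  have h2 := h1.comp x ((hasFDerivAt_id x).const_sub y)
  simp only [Function.comp_def] at h2
  rw [h2.fderiv]
  simp

/-- When the ball lies in `Ω`, the translated bump `x ↦ φ(y - x)` is an admissible test function, so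
the jump of the zero extension at the boundary is not seen. -/
lemma fderiv_mollify (hΩ : IsOpen Ω) (hb : Bornology.IsBounded Ω)
    (hu : MemLp u ∞ (volume.restrict Ω)) (huv : HasWeakPartial Ω i u v)
    (hy : Metric.closedBall y φ.rOut ⊆ Ω) :
    fderiv ℝ (mollify φ Ω u) y (EuclideanSpace.single i 1) = mollify φ Ω v y := by
  have hloc := locallyIntegrable_indicator hΩ hb hu
  have hd := HasCompactSupport.hasFDerivAt_convolution_left (ContinuousLinearMap.lsmul ℝ ℝ)
    (φ.hasCompactSupport_normed (μ := volume)) (φ.contDiff_normed (n := 1)) hloc y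
  have hts : tsupport (fun x => φ.normed volume (y - x)) ⊆ Metric.closedBall y φ.rOut := by
    refine closure_minimal (fun x hx => ?_) Metric.isClosed_closedBall
    have : y - x ∈ Function.support (φ.normed volume) := hx
    rw [φ.support_normed_eq] at this
    simpa [dist_eq_norm, norm_sub_rev] using (Metric.mem_ball.1 this).le
  have hη := huv.2.2 (fun x => φ.normed volume (y - x))
    (φ.contDiff_normed.comp (contDiff_const.sub contDiff_id))
    (HasCompactSupport.of_support_subset_isCompact (isCompact_closedBall y φ.rOut)
      (subset_closure.trans hts)) (hts.trans hy)
  have hex : ConvolutionExistsAt (fderiv ℝ (φ.normed volume)) (Ω.indicator u) y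
      ((ContinuousLinearMap.lsmul ℝ ℝ).precompL (EuclideanSpace ℝ (Fin d))) volume :=
    (φ.hasCompactSupport_normed.fderiv ℝ).convolutionExists_left _
      ((φ.contDiff_normed (n := 1)).continuous_fderiv one_ne_zero) hloc y
  change fderiv ℝ (convolution (φ.normed volume) (Ω.indicator u)
    (ContinuousLinearMap.lsmul ℝ ℝ) volume) y (EuclideanSpace.single i 1) = _
  rw [hd.fderiv, mollify_eq hΩ, convolution_eq_swap]
  have hex' := hex.integrable_swap
  rw [ContinuousLinearMap.integral_apply (by simpa [ContinuousLinearMap.flip_apply] using hex')]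
  simp only [fderiv_normed_sub] at hη
  have h3 : ∫ x in Ω, v x * φ.normed volume (y - x)
      = ∫ x in Ω, u x * (fderiv ℝ (φ.normed volume) (y - x)) (EuclideanSpace.single i 1) := by
    rw [← neg_eq_iff_eq_neg.2 hη, ← integral_neg]
    simp
  simp_rw [mul_comm (φ.normed volume _)]
  rw [h3, ← integral_indicator hΩ.measurableSet]
  congr 1
  ext x
  by_cases hx : x ∈ Ω <;> simp [hx, ContinuousLinearMap.precompL_apply, mul_comm]

/-- A sequence of bump functions with radii tending to zero. -/
noncomputable def bumpSeq (d : ℕ) (n : ℕ) : ContDiffBump (0 : EuclideanSpace ℝ (Fin d)) where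
  rIn := 1 / ((n : ℝ) + 1)
  rOut := 2 / ((n : ℝ) + 1)
  rIn_pos := by positivity
  rIn_lt_rOut := by gcongr; norm_num

lemma tendsto_bumpSeq_rOut : Tendsto (fun n => (bumpSeq d n).rOut) atTop (𝓝 0) := by
  have := (tendsto_one_div_add_atTop_nhds_zero_nat (𝕜 := ℝ)).const_mul 2
  simpa [bumpSeq, div_eq_mul_inv] using this

lemma ae_tendsto_mollify (hΩ : IsOpen Ω) (hb : Bornology.IsBounded Ω)
    (hu : MemLp u ∞ (volume.restrict Ω)) :
    ∀ᵐ x ∂volume.restrict Ω, Tendsto (fun n => mollify (bumpSeq d n) Ω u x) atTop (𝓝 (u x)) := by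
  have h := ContDiffBump.ae_convolution_tendsto_right_of_locallyIntegrable (μ := volume)
    (K := 2) (tendsto_bumpSeq_rOut (d := d))
    (.of_forall fun n => le_of_eq (by simp only [bumpSeq]; ring))
    (locallyIntegrable_indicator hΩ hb hu)
  rw [ae_restrict_iff' hΩ.measurableSet]
  filter_upwards [h] with x hx hxΩ
  rw [indicator_of_mem hxΩ] at hx
  exact hx

/-- A compact subset of `Ω` has a thickening inside `Ω`, so one threshold for `n` serves all points,
directions and weak derivatives. -/
lemma eventually_fderiv_mollify (hΩ : IsOpen Ω) (hb : Bornology.IsBounded Ω)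
    (hu : MemLp u ∞ (volume.restrict Ω)) {Γ : Set (EuclideanSpace ℝ (Fin d))}
    (hΓ : IsCompact Γ) (hΓΩ : Γ ⊆ Ω) :
    ∀ᶠ n in atTop, ∀ y ∈ Γ, ∀ i v, HasWeakPartial Ω i u v →
      fderiv ℝ (mollify (bumpSeq d n) Ω u) y (EuclideanSpace.single i 1)
        = mollify (bumpSeq d n) Ω v y := by
  obtain ⟨δ, hδ, hδΩ⟩ := hΓ.exists_cthickening_subset_open hΩ hΓΩ
  filter_upwards [tendsto_bumpSeq_rOut.eventually (gt_mem_nhds hδ)] with n hn y hy i v huv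
  refine fderiv_mollify hΩ hb hu huv ?_
  exact (Metric.closedBall_subset_closedBall (le_of_lt hn)).trans
    ((Metric.closedBall_subset_cthickening hy δ).trans hδΩ)

/-- Needed to identify the bounded weak gradient of `w⁻¹` from `weight_inv` with the one occurring
in `weight_decay`. -/
lemma HasWeakPartial.ae_eq (hΩ : IsOpen Ω) {v' : EuclideanSpace ℝ (Fin d) → ℝ}
    (h : HasWeakPartial Ω i u v) (h' : HasWeakPartial Ω i u v') :
    v =ᵐ[volume.restrict Ω] v' := by
  have key : ∀ᵐ x ∂volume.restrict Ω, (v - v') x = 0 := by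
    rw [ae_restrict_iff' hΩ.measurableSet]
    refine hΩ.ae_eq_zero_of_integral_contDiff_smul_eq_zero (h.2.1.sub h'.2.1) ?_
    intro η hη hηc hηΩ
    have hsupp : ∀ x ∉ Ω, η x * (v - v') x = 0 := fun x hx => by
      rw [image_eq_zero_of_notMem_tsupport fun hx' => hx (hηΩ hx'), zero_mul]
    have hint : ∀ g, LocallyIntegrableOn g Ω volume → IntegrableOn (fun x => g x * η x) Ω := by
      intro g hg
      have h1 := (hg.integrableOn_compact_subset hηΩ hηc).mul_continuousOn
        hη.continuous.continuousOn hηc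
      refine (h1.integrable_of_forall_notMem_eq_zero fun x hx => ?_).integrableOn
      rw [image_eq_zero_of_notMem_tsupport hx, mul_zero]
    have h3 := (h.2.2 η hη hηc hηΩ).symm.trans (h'.2.2 η hη hηc hηΩ)
    simp only [smul_eq_mul]
    rw [← setIntegral_eq_integral_of_forall_compl_eq_zero hsupp]
    calc ∫ x in Ω, η x * (v - v') x = ∫ x in Ω, (v x * η x - v' x * η x) := by
          congr 1; ext x; simp only [Pi.sub_apply]; ring
      _ = 0 := by
          rw [integral_sub (hint v h.2.1) (hint v' h'.2.1)]
          linarith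
  filter_upwards [key] with x hx
  simpa [sub_eq_zero] using hx

end Mollification

/-! ### The spaces `W^{k,∞}` are closed under sums and products -/

section Sobolev

variable {d : ℕ} {Ω : Set (EuclideanSpace ℝ (Fin d))} {u v u' v' : EuclideanSpace ℝ (Fin d) → ℝ}
  {i : Fin d} {k : ℕ}

lemma MemSobolevInfty.memLp (h : MemSobolevInfty Ω k u) : MemLp u ∞ (volume.restrict Ω) := by
  cases k with
  | zero => exact h
  | succ k => exact h.1

lemma MemSobolevInfty.of_succ (h : MemSobolevInfty Ω (k + 1) u) : MemSobolevInfty Ω k u := by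
  induction k generalizing u with
  | zero => exact h.1
  | succ k ih =>
    refine ⟨h.1, fun i => ?_⟩
    obtain ⟨v, hv, hv'⟩ := h.2 i
    exact ⟨v, hv, ih hv'⟩

lemma locallyIntegrableOn_of_memLp_top (hb : Bornology.IsBounded Ω)
    (hu : MemLp u ∞ (volume.restrict Ω)) : LocallyIntegrableOn u Ω volume :=
  IntegrableOn.locallyIntegrableOn (integrable_of_memLp_top hb hu)

lemma integrable_mul_of_continuous {η : EuclideanSpace ℝ (Fin d) → ℝ} (hη : Continuous η)
    (hηc : HasCompactSupport η) (hb : Bornology.IsBounded Ω)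
    (hu : MemLp u ∞ (volume.restrict Ω)) :
    Integrable (fun x => u x * η x) (volume.restrict Ω) := by
  obtain ⟨C, hC⟩ := hη.bounded_above_of_compact_support hηc
  exact (integrable_of_memLp_top hb hu).mul_bdd hη.aestronglyMeasurable (.of_forall hC)

lemma continuous_fderiv_apply_single {η : EuclideanSpace ℝ (Fin d) → ℝ} (hη : ContDiff ℝ ∞ η) :
    Continuous (fun x => fderiv ℝ η x (EuclideanSpace.single i 1)) :=
  (hη.continuous_fderiv (by simp)).clm_apply continuous_const

lemma HasWeakPartial.add (hb : Bornology.IsBounded Ω) (hu : MemLp u ∞ (volume.restrict Ω))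
    (hv : MemLp v ∞ (volume.restrict Ω)) (hu' : MemLp u' ∞ (volume.restrict Ω))
    (hv' : MemLp v' ∞ (volume.restrict Ω)) (h : HasWeakPartial Ω i u u')
    (h' : HasWeakPartial Ω i v v') :
    HasWeakPartial Ω i (fun x => u x + v x) (fun x => u' x + v' x) := by
  refine ⟨h.1.add h'.1, h.2.1.add h'.2.1, fun η hη hηc hηΩ => ?_⟩
  have hdc : HasCompactSupport (fun x => fderiv ℝ η x (EuclideanSpace.single i 1)) :=
    hηc.fderiv_apply ℝ _
  have hd := continuous_fderiv_apply_single (i := i) hη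
  simp only [add_mul]
  rw [integral_add (integrable_mul_of_continuous hd hdc hb hu)
      (integrable_mul_of_continuous hd hdc hb hv),
    integral_add (integrable_mul_of_continuous hη.continuous hηc hb hu')
      (integrable_mul_of_continuous hη.continuous hηc hb hv'),
    h.2.2 η hη hηc hηΩ, h'.2.2 η hη hηc hηΩ]
  ring

lemma MemSobolevInfty.add (hb : Bornology.IsBounded Ω) (hu : MemSobolevInfty Ω k u)
    (hv : MemSobolevInfty Ω k v) : MemSobolevInfty Ω k (fun x => u x + v x) := by
  induction k generalizing u v with
  | zero => exact MemLp.add hu hv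
  | succ k ih =>
    refine ⟨hu.1.add hv.1, fun i => ?_⟩
    obtain ⟨u', hu', hu''⟩ := hu.2 i
    obtain ⟨v', hv', hv''⟩ := hv.2 i
    exact ⟨_, hu'.add hb hu.1 hv.1 hu''.memLp hv''.memLp hv', ih hu'' hv''⟩

lemma memSobolevInfty_zero : MemSobolevInfty Ω k (fun _ => 0) := by
  induction k with
  | zero => exact MemLp.zero'
  | succ k ih =>
    refine ⟨MemLp.zero', fun i => ⟨fun _ => 0, ⟨?_, ?_, fun η _ _ _ => by simp⟩, ih⟩⟩
    · exact locallyIntegrableOn_zero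
    · exact locallyIntegrableOn_zero

lemma MemSobolevInfty.sum {ι : Type*} (s : Finset ι) (hb : Bornology.IsBounded Ω)
    {g : ι → EuclideanSpace ℝ (Fin d) → ℝ} (hg : ∀ j, MemSobolevInfty Ω k (g j)) :
    MemSobolevInfty Ω k (fun x => ∑ j ∈ s, g j x) := by
  classical
  induction s using Finset.induction_on with
  | empty => simpa using memSobolevInfty_zero
  | insert a s ha ih =>
    simp only [Finset.sum_insert ha]
    exact (hg a).add hb ih

/-- Only one factor is mollified: with `uₙ` smooth, `uₙ η` is a test function for the weak
derivative of `v`, and dominated convergence removes the mollification. -/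
lemma HasWeakPartial.mul (hΩ : IsOpen Ω) (hb : Bornology.IsBounded Ω)
    (hu : MemLp u ∞ (volume.restrict Ω)) (hv : MemLp v ∞ (volume.restrict Ω))
    (hu' : MemLp u' ∞ (volume.restrict Ω)) (hv' : MemLp v' ∞ (volume.restrict Ω))
    (h : HasWeakPartial Ω i u u') (h' : HasWeakPartial Ω i v v') :
    HasWeakPartial Ω i (fun x => u x * v x) (fun x => u' x * v x + u x * v' x) := by
  have huv : MemLp (fun x => u x * v x) ∞ (volume.restrict Ω) := hv.mul' hu
  have huv' : MemLp (fun x => u' x * v x + u x * v' x) ∞ (volume.restrict Ω) :=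
    (hv.mul' hu').add (hv'.mul' hu)
  refine ⟨locallyIntegrableOn_of_memLp_top hb huv, locallyIntegrableOn_of_memLp_top hb huv',
    fun η hη hηc hηΩ => ?_⟩
  have hdc : HasCompactSupport (fun x => fderiv ℝ η x (EuclideanSpace.single i 1)) :=
    hηc.fderiv_apply ℝ _
  have hd := continuous_fderiv_apply_single (i := i) hη
  have hlim : ∀ {a b : EuclideanSpace ℝ (Fin d) → ℝ} {ξ : EuclideanSpace ℝ (Fin d) → ℝ},
      MemLp a ∞ (volume.restrict Ω) → MemLp b ∞ (volume.restrict Ω) → Continuous ξ →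
      HasCompactSupport ξ → Tendsto (fun n => ∫ x in Ω, b x * mollify (bumpSeq d n) Ω a x * ξ x)
        atTop (𝓝 (∫ x in Ω, b x * a x * ξ x)) := by
    intro a b ξ ha hb' hξ hξc
    obtain ⟨C, hC, haC⟩ := exists_bound_of_memLp_top ha
    refine tendsto_integral_of_dominated_convergence (fun x => C * |b x * ξ x|) (fun n => ?_)
      ((integrable_mul_of_continuous hξ hξc hb hb').abs.const_mul C) (fun n => ?_) ?_
    · exact (hb'.1.mul (contDiff_mollify hΩ hb ha).continuous.aestronglyMeasurable).mul
        hξ.aestronglyMeasurable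
    · refine .of_forall fun x => ?_
      have := abs_mollify_le (φ := bumpSeq d n) (y := x) hΩ hC haC
      rw [Real.norm_eq_abs, show b x * mollify (bumpSeq d n) Ω a x * ξ x
        = mollify (bumpSeq d n) Ω a x * (b x * ξ x) by ring, abs_mul]
      exact mul_le_mul_of_nonneg_right this (abs_nonneg _)
    · filter_upwards [ae_tendsto_mollify hΩ hb ha] with x hx
      exact (hx.const_mul _).mul_const _
  have hident : ∀ᶠ n in atTop,
      (∫ x in Ω, v x * mollify (bumpSeq d n) Ω u' x * η x)
        + (∫ x in Ω, v x * mollify (bumpSeq d n) Ω u x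
            * fderiv ℝ η x (EuclideanSpace.single i 1))
      = - ∫ x in Ω, v' x * mollify (bumpSeq d n) Ω u x * η x := by
    filter_upwards [eventually_fderiv_mollify hΩ hb hu hηc hηΩ] with n hn
    have hm := contDiff_mollify (φ := bumpSeq d n) hΩ hb hu
    have hm' := contDiff_mollify (φ := bumpSeq d n) hΩ hb hu'
    have hprod := h'.2.2 (fun x => mollify (bumpSeq d n) Ω u x * η x) (hm.mul hη)
      hηc.mul_left ((closure_mono (Function.support_mul_subset_right _ _)).trans hηΩ)
    have hfd : ∀ x, fderiv ℝ (fun x => mollify (bumpSeq d n) Ω u x * η x) x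
        (EuclideanSpace.single i 1) = mollify (bumpSeq d n) Ω u' x * η x
          + mollify (bumpSeq d n) Ω u x * fderiv ℝ η x (EuclideanSpace.single i 1) := by
      intro x
      rw [fderiv_fun_mul (hm.differentiable (by simp) x) (hη.differentiable (by simp) x)]
      simp only [add_apply, smul_apply, smul_eq_mul]
      by_cases hx : x ∈ tsupport η
      · rw [hn x hx i u' h]
        ring
      · rw [image_eq_zero_of_notMem_tsupport hx]
        ring
    simp only [hfd] at hprod
    simp only [← mul_assoc] at hprod
    rw [← hprod, ← integral_add]
    · congr 1
      ext x
      ring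
    · have := integrable_mul_of_continuous (hm'.continuous.mul hη.continuous) hηc.mul_left hb hv
      simpa only [mul_assoc] using! this
    · have := integrable_mul_of_continuous (hm.continuous.mul hd) hdc.mul_left hb hv
      simpa only [mul_assoc] using! this
  have h1 := (hlim hu' hv hη.continuous hηc).add (hlim hu hv hd hdc)
  have h2 := (hlim hu hv' hη.continuous hηc).neg
  have h3 := tendsto_nhds_unique (h1.congr' hident) h2
  have h4 : ∫ x in Ω, (u' x * v x + u x * v' x) * η x
      = (∫ x in Ω, v x * u' x * η x) + ∫ x in Ω, v' x * u x * η x := by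
    rw [← integral_add]
    · congr 1
      ext x
      ring
    · exact integrable_mul_of_continuous hη.continuous hηc hb (hu'.mul' hv)
    · exact integrable_mul_of_continuous hη.continuous hηc hb (hu.mul' hv')
  rw [h4]
  have h5 : ∀ x, u x * v x = v x * u x := fun x => mul_comm _ _
  simp only [h5]
  linarith

lemma MemSobolevInfty.mul (hΩ : IsOpen Ω) (hb : Bornology.IsBounded Ω)
    (hu : MemSobolevInfty Ω k u) (hv : MemSobolevInfty Ω k v) :
    MemSobolevInfty Ω k (fun x => u x * v x) := by
  induction k generalizing u v with
  | zero => exact MemLp.mul' hv hu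
  | succ k ih =>
    refine ⟨MemLp.mul' hv.1 hu.1, fun i => ?_⟩
    obtain ⟨u', hu', hu''⟩ := hu.2 i
    obtain ⟨v', hv', hv''⟩ := hv.2 i
    exact ⟨_, hu'.mul hΩ hb hu.1 hv.1 hu''.memLp hv''.memLp hv',
      (ih hu'' hv.of_succ).add hb (ih hu.of_succ hv'')⟩

end Sobolev

/-! ### Weak derivatives along trajectories -/

section FlowDerivative

variable {d : ℕ} {f : EuclideanSpace ℝ (Fin d) → EuclideanSpace ℝ (Fin d)}
  {Ω : Set (EuclideanSpace ℝ (Fin d))} {w u h : EuclideanSpace ℝ (Fin d) → ℝ}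

/-- Along almost every trajectory, `u` is the primitive of `h`. -/
def HasFlowDerivative (f : EuclideanSpace ℝ (Fin d) → EuclideanSpace ℝ (Fin d))
    (Ω : Set (EuclideanSpace ℝ (Fin d))) (u h : EuclideanSpace ℝ (Fin d) → ℝ) : Prop :=
  ∃ G : Set (EuclideanSpace ℝ (Fin d)), (∀ᵐ y ∂volume.restrict Ω, y ∈ G) ∧
    ∀ x ∈ Ω, x ∈ G → (∀ᵐ τ ∂volume.restrict (Ioi (0 : ℝ)), flow f τ x ∈ G) →
      ∀ t, 0 ≤ t → flow f t x ∈ G → u (flow f t x) = u x + ∫ τ in 0..t, h (flow f τ x)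

/-- For mollified `u` this is the fundamental theorem of calculus along a compact piece of
trajectory in `Ω`. The limit exists at the endpoints and at almost every intermediate time, and the
integrands are uniformly bounded. -/
lemma hasFlowDerivative_of_hasWeakPartial (hΩ : IsOpen Ω) (hbd : HasC1Boundary Ω)
    (hf : ContDiff ℝ 1 f) (hb : Bornology.IsBounded Ω) (hinv : FlowInvariant f Ω)
    (hu : MemLp u ∞ (volume.restrict Ω)) {v : Fin d → EuclideanSpace ℝ (Fin d) → ℝ}
    (hv : ∀ i, MemLp (v i) ∞ (volume.restrict Ω)) (huv : ∀ i, HasWeakPartial Ω i u (v i)) :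
    HasFlowDerivative f Ω u (fun x => ∑ i, f x i * v i x) := by
  -- The good set is the set of points where all mollifications converge. It does not depend on `t`,
  -- so the identity can be used both at a fixed time and at almost every time of a fixed
  -- trajectory.
  refine ⟨{y | Tendsto (fun n => mollify (bumpSeq d n) Ω u y) atTop (𝓝 (u y)) ∧
    ∀ i, Tendsto (fun n => mollify (bumpSeq d n) Ω (v i) y) atTop (𝓝 (v i y))}, ?_, ?_⟩
  · filter_upwards [ae_tendsto_mollify hΩ hb hu,
      eventually_countable_forall.2 fun i => ae_tendsto_mollify hΩ hb (hv i)] with y h1 h2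
    exact ⟨h1, h2⟩
  intro x hx hxG hτ t ht htG
  have hxc := subset_closure hx
  have hcont : ContinuousOn (fun τ => flow f τ x) (Icc 0 t) :=
    (continuousOn_flow_time hf hinv hxc).mono Icc_subset_Ici_self
  have hmaps : ∀ τ ∈ Icc 0 t, flow f τ x ∈ Ω := fun τ hτ => flow_mem hΩ hbd hf hinv hx hτ.1
  have hΓ : IsCompact ((fun τ => flow f τ x) '' Icc 0 t) := isCompact_Icc.image_of_continuousOn hcont
  have hfc : ContinuousOn (fun τ => f (flow f τ x)) (Icc 0 t) :=
    hf.continuous.comp_continuousOn hcont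
  obtain ⟨Cf, hCf⟩ := isCompact_Icc.exists_bound_of_continuousOn hfc
  choose C hC0 hC using fun i => exists_bound_of_memLp_top (hv i)
  have hmc : ∀ n i, Continuous (mollify (bumpSeq d n) Ω (v i)) :=
    fun n i => (contDiff_mollify hΩ hb (hv i)).continuous
  have hIcont : ∀ n, ContinuousOn
      (fun τ => ∑ i, f (flow f τ x) i * mollify (bumpSeq d n) Ω (v i) (flow f τ x)) (Icc 0 t) :=
    fun n => continuousOn_finsetSum _ fun i _ =>
      ((EuclideanSpace.proj i).continuous.comp_continuousOn hfc).mul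
        ((hmc n i).comp_continuousOn hcont)
  have hFTC : ∀ᶠ n in atTop, ∫ τ in 0..t, (∑ i, f (flow f τ x) i *
        mollify (bumpSeq d n) Ω (v i) (flow f τ x))
      = mollify (bumpSeq d n) Ω u (flow f t x) - mollify (bumpSeq d n) Ω u x := by
    filter_upwards [eventually_fderiv_mollify hΩ hb hu hΓ (image_subset_iff.2 hmaps)] with n hn
    have hm := contDiff_mollify (φ := bumpSeq d n) hΩ hb hu
    have h0 := intervalIntegral.integral_eq_sub_of_hasDeriv_right (a := 0) (b := t)
      (f := fun τ => mollify (bumpSeq d n) Ω u (flow f τ x))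
      (f' := fun τ => ∑ i, f (flow f τ x) i * mollify (bumpSeq d n) Ω (v i) (flow f τ x))
      (by rw [uIcc_of_le ht]; exact hm.continuous.comp_continuousOn hcont) ?_
      (by
        apply ContinuousOn.intervalIntegrable
        rw [uIcc_of_le ht]
        exact hIcont n)
    · rw [h0, flow_zero hf hinv hxc]
    · intro τ hτ
      rw [min_eq_left ht, max_eq_right ht] at hτ
      have hd1 := (isIntegralCurveOn_flow hf hinv hxc τ hτ.1.le).mono
        (Ioi_subset_Ici hτ.1.le)
      have hd2 := (hm.differentiable (by simp) (flow f τ x)).hasFDerivAt.comp_hasDerivWithinAt τ hd1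
      refine HasDerivWithinAt.congr_deriv hd2 ?_
      have hmem : flow f τ x ∈ (fun τ => flow f τ x) '' Icc 0 t :=
        ⟨τ, Ioo_subset_Icc_self hτ, rfl⟩
      set F := f (flow f τ x) with hF
      have hsum : F = ∑ i, F i • EuclideanSpace.single i (1 : ℝ) := by
        ext j
        simp [Pi.single_apply]
      change fderiv ℝ (mollify (bumpSeq d n) Ω u) (flow f τ x) F = _
      conv_lhs => rw [hsum, map_sum]
      refine Finset.sum_congr rfl fun i _ => ?_
      rw [map_smul, hn _ hmem i (v i) (huv i), smul_eq_mul]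
  have hL : Tendsto (fun n => ∫ τ in 0..t, (∑ i, f (flow f τ x) i *
      mollify (bumpSeq d n) Ω (v i) (flow f τ x))) atTop
      (𝓝 (∫ τ in 0..t, (∑ i, f (flow f τ x) i * v i (flow f τ x)))) := by
    refine intervalIntegral.tendsto_integral_filter_of_dominated_convergence
      (fun _ => ∑ i, Cf * C i) (.of_forall fun n => ?_) (.of_forall fun n => ?_)
      intervalIntegrable_const ?_
    · rw [uIoc_of_le ht]
      exact ((hIcont n).mono Ioc_subset_Icc_self).aestronglyMeasurable measurableSet_Ioc
    · refine .of_forall fun τ hτ => ?_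
      rw [uIoc_of_le ht] at hτ
      refine norm_sum_le_of_le _ fun i _ => ?_
      rw [norm_mul]
      refine mul_le_mul ((PiLp.norm_apply_le _ i).trans (hCf τ (Ioc_subset_Icc_self hτ)))
        (abs_mollify_le hΩ (hC0 i) (hC i)) (norm_nonneg _) ?_
      exact (norm_nonneg _).trans (hCf τ (Ioc_subset_Icc_self hτ))
    · rw [ae_restrict_iff' measurableSet_Ioi] at hτ
      filter_upwards [hτ] with τ hτ hτt
      rw [uIoc_of_le ht] at hτt
      exact tendsto_finsetSum _ fun i _ => ((hτ hτt.1).2 i).const_mul _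
  have hR := htG.1.sub hxG.1
  have := tendsto_nhds_unique (hL.congr' hFTC) hR
  linarith

lemma HasFlowDerivative.ae (hΩ : IsOpen Ω) (hbd : HasC1Boundary Ω)
    (hf : ContDiff ℝ 1 f) (hb : Bornology.IsBounded Ω) (hinv : FlowInvariant f Ω)
    (hu : HasFlowDerivative f Ω u h) {t : ℝ} (ht : 0 ≤ t) :
    ∀ᵐ x ∂volume.restrict Ω, u (flow f t x) = u x + ∫ τ in 0..t, h (flow f τ x) := by
  obtain ⟨G, hG, hGu⟩ := hu
  filter_upwards [hG, ae_flow hΩ hbd hf hb hinv hG ht, ae_ae_flow hΩ hbd hf hb hinv hG,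
    ae_restrict_mem hΩ.measurableSet] with x h1 h2 h3 h4
  exact hGu x h4 h1 h3 t ht h2

lemma HasFlowDerivative.ae_ae (hΩ : IsOpen Ω) (hbd : HasC1Boundary Ω)
    (hf : ContDiff ℝ 1 f) (hb : Bornology.IsBounded Ω) (hinv : FlowInvariant f Ω)
    (hu : HasFlowDerivative f Ω u h) :
    ∀ᵐ x ∂volume.restrict Ω, ∀ᵐ t ∂volume.restrict (Ioi (0 : ℝ)),
      u (flow f t x) = u x + ∫ τ in 0..t, h (flow f τ x) := by
  obtain ⟨G, hG, hGu⟩ := hu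
  filter_upwards [hG, ae_ae_flow hΩ hbd hf hb hinv hG, ae_restrict_mem hΩ.measurableSet]
    with x h1 h3 h4
  filter_upwards [h3, ae_restrict_mem measurableSet_Ioi] with t ht1 ht2
  exact hGu x h4 h1 h3 t (le_of_lt ht2) ht1

/-- `u` has `k` derivatives along the flow, and all of them belong to `X*`. -/
def IsSmoothAlongFlow (f : EuclideanSpace ℝ (Fin d) → EuclideanSpace ℝ (Fin d))
    (Ω : Set (EuclideanSpace ℝ (Fin d))) (w : EuclideanSpace ℝ (Fin d) → ℝ) :
    ℕ → (EuclideanSpace ℝ (Fin d) → ℝ) → Prop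
  | 0, u => MemXDual Ω w u
  | k + 1, u => MemXDual Ω w u ∧
      ∃ h, HasFlowDerivative f Ω u h ∧ IsSmoothAlongFlow f Ω w k h

/-- The weighted bound on `f` compensates the missing one on the gradient, so that each `f · ∇u` is
again in `X*` and inherits exponential decay along the flow. -/
lemma memXDual_sum_mul {v : Fin d → EuclideanSpace ℝ (Fin d) → ℝ}
    (hfw : ∀ i, MemXDual Ω w (fun x => f x i)) (hv : ∀ i, MemLp (v i) ∞ (volume.restrict Ω)) :
    MemXDual Ω w (fun x => ∑ i, f x i * v i x) := by
  have h1 : MemLp (fun x => ∑ i, v i x * (f x i * w x)) ∞ (volume.restrict Ω) :=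
    memLp_finsetSum _ fun i _ => (hfw i).mul' (hv i)
  refine (memLp_congr_ae (.of_forall fun x => ?_)).1 h1
  simp only [Finset.sum_mul]
  exact Finset.sum_congr rfl fun i _ => by ring

/-- Each application of `f · ∇` costs one order of `u`. The first one already lands in `W^{k-1,∞}`,
so `f` is needed to one order less than `u`. -/
lemma isSmoothAlongFlow_of_memSobolevInfty {k : ℕ} (hadm : IsAdmissible f Ω w)
    (hfk : ∀ j, MemSobolevInfty Ω (k - 1) (fun x => f x j)) (hu : MemSobolevInfty Ω k u)
    (huw : MemXDual Ω w u) : IsSmoothAlongFlow f Ω w k u := by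
  induction k generalizing u with
  | zero => exact huw
  | succ k ih =>
    choose v hv hvk using hu.2
    have hfk' : ∀ j, MemSobolevInfty Ω k (fun x => f x j) := hfk
    refine ⟨huw, _, hasFlowDerivative_of_hasWeakPartial hadm.isOpen hadm.boundary hadm.dynamics
      hadm.isBounded hadm.invariant hu.1 (fun i => (hvk i).memLp) hv, ih (fun j => ?_) ?_
      (memXDual_sum_mul hadm.dynamics_weighted fun i => (hvk i).memLp)⟩
    · cases k with
      | zero => exact hfk j
      | succ k => exact (hfk' j).of_succ
    · exact MemSobolevInfty.sum _ hadm.isBounded fun j =>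
        (hfk' j).mul hadm.isOpen hadm.isBounded (hvk j)

end FlowDerivative

/-! ### Gronwall for integrable functions; pushing densities forward -/

section General

lemma gronwall_integral_of_integrable {β : ℝ → ℝ} {a K T : ℝ} (hK : 0 ≤ K)
    (hβ : Integrable β volume)
    (hle : ∀ᵐ τ ∂volume.restrict (Ioc 0 T), β τ ≤ K * (a + ∫ s in 0..τ, β s))
    {t : ℝ} (ht : t ∈ Icc 0 T) : a + ∫ s in 0..t, β s ≤ a * Real.exp (K * t) := by
  set η : ℝ → ℝ := fun t => a + ∫ s in 0..t, β s with hη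
  have hηc : Continuous η :=
    continuous_const.add (intervalIntegral.continuous_primitive (fun _ _ => hβ.intervalIntegrable) 0)
  -- The primitive `η` of an integrable function need not be differentiable everywhere; its `C¹`
  -- majorant `H` satisfies `H' = Kη ≤ KH`, to which the classical lemma applies.
  set H : ℝ → ℝ := fun t => a + ∫ s in 0..t, K * η s with hH
  have hHd : ∀ t, HasDerivAt H (K * η t) t := fun t =>
    (intervalIntegral.integral_hasDerivAt_right ((hηc.const_mul K).intervalIntegrable _ _)
      ((hηc.const_mul K).stronglyMeasurableAtFilter _ _)
      (hηc.const_mul K).continuousAt).const_add a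
  have hle' : ∀ t ∈ Icc 0 T, η t ≤ H t := by
    intro t ht
    refine add_le_add le_rfl ?_
    refine intervalIntegral.integral_mono_ae_restrict ht.1 hβ.intervalIntegrable
      ((hηc.const_mul K).intervalIntegrable _ _) ?_
    have h1 : ∀ᵐ τ ∂volume.restrict (Ioc 0 t), β τ ≤ K * η τ :=
      ae_restrict_of_ae_restrict_of_subset (Ioc_subset_Ioc_right ht.2) hle
    rw [← restrict_Ioc_eq_restrict_Icc]
    exact h1
  have h := le_gronwallBound_of_liminf_deriv_right_le (f := H) (f' := fun t => K * η t) (δ := a)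
    (K := K) (ε := 0) (a := 0) (b := T) (fun t _ => (hHd t).continuousAt.continuousWithinAt)
    (fun t _ r hr => by
      simpa [slope] using! (hHd t).hasDerivWithinAt.liminf_right_slope_le hr)
    (by simp [hH]) (fun t ht => by
      rw [add_zero]
      exact mul_le_mul_of_nonneg_left (hle' t (Ico_subset_Icc_self ht)) hK) t ht
  rw [gronwallBound_ε0, sub_zero] at h
  exact (hle' t ht).trans h

lemma gronwall_integral {β : ℝ → ℝ} {a K T : ℝ} (hK : 0 ≤ K)
    (hβ : IntegrableOn β (Ioc 0 T) volume)
    (hle : ∀ᵐ τ ∂volume.restrict (Ioc 0 T), β τ ≤ K * (a + ∫ s in 0..τ, β s))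
    {t : ℝ} (ht : t ∈ Icc 0 T) : a + ∫ s in 0..t, β s ≤ a * Real.exp (K * t) := by
  have hint : ∀ τ ∈ Icc 0 T, ∫ s in 0..τ, (Ioc 0 T).indicator β s = ∫ s in 0..τ, β s := by
    intro τ hτ
    refine intervalIntegral.integral_congr_ae (.of_forall fun s hs => ?_)
    rw [uIoc_of_le hτ.1] at hs
    exact indicator_of_mem (Ioc_subset_Ioc_right hτ.2 hs) β
  have h := gronwall_integral_of_integrable (a := a) (T := T) hK
    ((integrable_indicator_iff measurableSet_Ioc).2 hβ) (by
      filter_upwards [hle, ae_restrict_mem measurableSet_Ioc] with τ h1 h2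
      rwa [hint τ (Ioc_subset_Icc_self h2), indicator_of_mem h2]) ht
  rwa [hint t ht] at h

/-- The bounds along the flow come for each time separately, on sets that are only null measurable.
A measurable subset of the exceptional set, equal to it up to a null set, reduces this to Fubini. -/
lemma ae_prod_of_ae_ae {α β : Type*} [MeasurableSpace α] [MeasurableSpace β] {μ : Measure α}
    {ν : Measure β} [SFinite μ] [SFinite ν] {p : α × β → Prop}
    (hp : NullMeasurableSet {z | p z} (μ.prod ν)) (h : ∀ᵐ y ∂ν, ∀ᵐ x ∂μ, p (x, y)) :
    ∀ᵐ z ∂μ.prod ν, p z := by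
  obtain ⟨q, hqp, hq, hqe⟩ := hp.compl.exists_measurable_subset_ae_eq
  rw [ae_iff]
  change μ.prod ν {z | p z}ᶜ = 0
  rw [← measure_congr hqe, ← compl_compl q]
  have h1 : ∀ᵐ z ∂μ.prod ν, z ∈ qᶜ := by
    refine (Measure.ae_prod_iff_ae_ae hq.compl).2 ?_
    refine (Measure.ae_ae_comm (p := fun x y => (x, y) ∈ qᶜ) hq.compl).2 ?_
    filter_upwards [h] with y hy
    filter_upwards [hy] with x hx hxq
    exact hqp hxq hx
  exact h1

/-- A nonnegative integrable density can be pushed forward along a map that does not concentrate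
mass on null sets. -/
lemma exists_pushforward_density_of_nonneg {α : Type*} [MeasurableSpace α] {μ : Measure α}
    [SigmaFinite μ] {T : α → α} (hT : AEMeasurable T μ) (hTμ : μ.map T ≪ μ) {g : α → ℝ}
    (hg : Integrable g μ) (hg0 : ∀ x, 0 ≤ g x) :
    ∃ κ : α → ℝ, Integrable κ μ ∧ ∀ b : α → ℝ, AEStronglyMeasurable b μ →
      ∫ x, κ x * b x ∂μ = ∫ x, g x * b (T x) ∂μ := by
  set ν := μ.withDensity fun x => ENNReal.ofReal (g x) with hν
  have hνμ : ν ≪ μ := withDensity_absolutelyContinuous _ _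
  have : IsFiniteMeasure ν := isFiniteMeasure_withDensity_ofReal hg.2
  have hTν : AEMeasurable T ν := hT.mono_ac hνμ
  have hmap : ν.map T ≪ μ := by
    refine Measure.AbsolutelyContinuous.mk fun s hs h => ?_
    rw [Measure.map_apply_of_aemeasurable hTν hs]
    refine hνμ ?_
    rw [← Measure.map_apply_of_aemeasurable hT hs]
    exact hTμ h
  refine ⟨fun x => ((ν.map T).rnDeriv μ x).toReal, Measure.integrable_toReal_rnDeriv,
    fun b hb => ?_⟩
  have h1 := integral_rnDeriv_smul (f := b) hmap
  simp only [smul_eq_mul] at h1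
  rw [h1, integral_map hTν (hb.mono_ac hmap), hν,
    integral_withDensity_eq_integral_toReal_smul₀ hg.1.aemeasurable.ennreal_ofReal
      (.of_forall fun _ => ENNReal.ofReal_lt_top)]
  simp [hg0]

lemma exists_pushforward_density {α : Type*} [MeasurableSpace α] {μ : Measure α}
    [SigmaFinite μ] {T : α → α} (hT : AEMeasurable T μ) (hTμ : μ.map T ≪ μ) {g : α → ℝ}
    (hg : Integrable g μ) :
    ∃ κ : α → ℝ, Integrable κ μ ∧ ∀ b : α → ℝ, MemLp b ∞ μ →
      ∫ x, κ x * b x ∂μ = ∫ x, g x * b (T x) ∂μ := by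
  obtain ⟨κ₁, h₁, h₁'⟩ := exists_pushforward_density_of_nonneg hT hTμ hg.pos_part
    fun x => le_max_right _ _
  obtain ⟨κ₂, h₂, h₂'⟩ := exists_pushforward_density_of_nonneg hT hTμ hg.neg_part
    fun x => le_max_right _ _
  refine ⟨fun x => κ₁ x - κ₂ x, h₁.sub h₂, fun b hb => ?_⟩
  have hbT : MemLp (fun x => b (T x)) ∞ μ :=
    ⟨(hb.1.mono_ac hTμ).comp_aemeasurable hT, by
      have hlt := hb.2
      have hle := ae_of_ae_map hT (hTμ.ae_le (ae_le_eLpNormEssSup (f := b) (μ := μ)))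
      rw [eLpNorm_exponent_top] at hlt ⊢
      exact (essSup_le_of_ae_le _ hle).trans_lt hlt⟩
  have hi : ∀ k : α → ℝ, Integrable k μ → ∀ b : α → ℝ, MemLp b ∞ μ →
      Integrable (fun x => k x * b x) μ := by
    intro k hk b hb
    exact memLp_one_iff_integrable.1 (MemLp.mul' (p := 1) (q := ∞) hb (memLp_one_iff_integrable.2 hk))
  simp only [sub_mul]
  rw [integral_sub (hi _ h₁ b hb) (hi _ h₂ b hb), h₁' b hb.1, h₂' b hb.1,
    ← integral_sub (hi _ hg.pos_part _ hbT) (hi _ hg.neg_part _ hbT)]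
  refine integral_congr_ae (.of_forall fun x => ?_)
  simp only [← sub_mul]
  congr 1
  rcases le_total 0 (g x) with h | h
  · simp [h]
  · simp [h]

end General

/-! ### The weight along the flow and the preadjoint semigroup -/

section Semigroup

variable {d : ℕ} {f : EuclideanSpace ℝ (Fin d) → EuclideanSpace ℝ (Fin d)}
  {Ω : Set (EuclideanSpace ℝ (Fin d))} {w u ψ φ : EuclideanSpace ℝ (Fin d) → ℝ} {t : ℝ}

lemma IsAdmissible.ae_flow (hadm : IsAdmissible f Ω w) {P : EuclideanSpace ℝ (Fin d) → Prop}
    (hP : ∀ᵐ y ∂volume.restrict Ω, P y) (ht : 0 ≤ t) :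
    ∀ᵐ x ∂volume.restrict Ω, P (flow f t x) :=
  KoopmanLyapunov.ae_flow hadm.isOpen hadm.boundary hadm.dynamics hadm.isBounded hadm.invariant
    hP ht

lemma IsAdmissible.ae_ae_flow (hadm : IsAdmissible f Ω w) {P : EuclideanSpace ℝ (Fin d) → Prop}
    (hP : ∀ᵐ y ∂volume.restrict Ω, P y) :
    ∀ᵐ x ∂volume.restrict Ω, ∀ᵐ t ∂volume.restrict (Ioi (0 : ℝ)), P (flow f t x) :=
  KoopmanLyapunov.ae_ae_flow hadm.isOpen hadm.boundary hadm.dynamics hadm.isBounded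
    hadm.invariant hP

lemma IsAdmissible.aemeasurable_flow (hadm : IsAdmissible f Ω w) (ht : 0 ≤ t) :
    AEMeasurable (flow f t) (volume.restrict Ω) :=
  KoopmanLyapunov.aemeasurable_flow hadm.isOpen hadm.dynamics hadm.isBounded hadm.invariant ht

lemma IsAdmissible.map_flow (hadm : IsAdmissible f Ω w) (ht : 0 ≤ t) :
    (volume.restrict Ω).map (flow f t) ≪ volume.restrict Ω :=
  map_flow_absolutelyContinuous hadm.isOpen hadm.boundary hadm.dynamics hadm.isBounded
    hadm.invariant ht

lemma IsAdmissible.aemeasurable_comp_flow (hadm : IsAdmissible f Ω w) (ht : 0 ≤ t)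
    (hu : AEMeasurable u (volume.restrict Ω)) :
    AEMeasurable (fun x => u (flow f t x)) (volume.restrict Ω) :=
  (hu.mono_ac (hadm.map_flow ht)).comp_aemeasurable (hadm.aemeasurable_flow ht)

lemma IsAdmissible.aemeasurable_comp_flow_prod (hadm : IsAdmissible f Ω w)
    (hu : AEMeasurable u (volume.restrict Ω)) :
    AEMeasurable (fun p : EuclideanSpace ℝ (Fin d) × ℝ => u (flow f p.2 p.1))
      ((volume.restrict Ω).prod (volume.restrict (Ioi 0))) :=
  (hu.mono_ac (map_flow_prod_absolutelyContinuous hadm.isOpen hadm.boundary hadm.dynamics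
    hadm.isBounded hadm.invariant)).comp_aemeasurable
    (aemeasurable_flow_prod hadm.isOpen hadm.dynamics hadm.isBounded hadm.invariant)

lemma aemeasurable_of_memXDual (hadm : IsAdmissible f Ω w) (hu : MemXDual Ω w u) :
    AEMeasurable u (volume.restrict Ω) := by
  refine (hu.1.aemeasurable.mul hadm.weight_measurable.inv).congr ?_
  filter_upwards [hadm.weight_pos] with x hx
  simp [hx.ne']

lemma exists_abs_le_of_memXDual (hadm : IsAdmissible f Ω w) (hu : MemXDual Ω w u) :
    ∃ C, 0 ≤ C ∧ ∀ᵐ x ∂volume.restrict Ω, |u x| ≤ C * (w x)⁻¹ := by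
  obtain ⟨C, hC, hu⟩ := exists_bound_of_memLp_top hu
  refine ⟨C, hC, ?_⟩
  filter_upwards [hu, hadm.weight_pos] with x hx hw
  rwa [abs_mul, abs_of_pos hw, ← le_div_iff₀ hw, div_eq_mul_inv] at hx

lemma memXDual_of_abs_le (hadm : IsAdmissible f Ω w) {C : ℝ}
    (hu : AEMeasurable u (volume.restrict Ω))
    (h : ∀ᵐ x ∂volume.restrict Ω, |u x| ≤ C * (w x)⁻¹) : MemXDual Ω w u := by
  refine memLp_top_of_abs_le (C := C) (hu.mul hadm.weight_measurable).aestronglyMeasurable ?_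
  filter_upwards [h, hadm.weight_pos] with x hx hw
  rwa [abs_mul, abs_of_pos hw, ← le_div_iff₀ hw, div_eq_mul_inv]

lemma memXDual_inv_weight (hadm : IsAdmissible f Ω w) : MemXDual Ω w (fun x => (w x)⁻¹) := by
  refine memXDual_of_abs_le (C := 1) hadm hadm.weight_measurable.inv ?_
  filter_upwards [hadm.weight_pos] with x hw
  rw [abs_of_pos (inv_pos.2 hw), one_mul]

/-- Along the flow, `w⁻¹` has derivative `f · ∇(w⁻¹) = (-f · ∇w / w) w⁻¹`, which is at most a
constant times `w⁻¹`; Gronwall finishes. Growth is allowed here: this bound only serves to construct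
`S(t)`. -/
lemma exists_inv_weight_flow_le_exp (hadm : IsAdmissible f Ω w) :
    ∃ K : ℝ, ∀ t, 0 ≤ t → ∀ᵐ x ∂volume.restrict Ω,
      (w (flow f t x))⁻¹ ≤ Real.exp (K * t) * (w x)⁻¹ := by
  obtain ⟨hv, hv1⟩ := hadm.weight_inv
  choose v hvw hvb using hv1
  replace hvb : ∀ i, MemLp (v i) ∞ (volume.restrict Ω) := hvb
  obtain ⟨ω₀, g, hg, hgω⟩ := hadm.weight_decay
  set h : EuclideanSpace ℝ (Fin d) → ℝ := fun x => ∑ i, f x i * v i x with hh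
  have hder : HasFlowDerivative f Ω (fun x => (w x)⁻¹) h :=
    hasFlowDerivative_of_hasWeakPartial hadm.isOpen hadm.boundary hadm.dynamics
      hadm.isBounded hadm.invariant hv hvb hvw
  have hle : ∀ᵐ x ∂volume.restrict Ω, 0 < w x ∧ h x ≤ max ω₀ 0 * (w x)⁻¹ := by
    have hgv := eventually_countable_forall.2 fun i => (hvw i).ae_eq hadm.isOpen (hg i)
    filter_upwards [hgv, hgω, hadm.weight_pos] with x h1 h2 hw
    refine ⟨hw, ?_⟩
    have h3 : -(∑ i, f x i * (-(w x ^ 2) * g i x)) / w x = w x * h x := by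
      have : ∑ i, f x i * (-(w x ^ 2) * g i x) = -(w x ^ 2) * h x := by
        rw [hh, Finset.mul_sum]
        exact Finset.sum_congr rfl fun i _ => by rw [h1 i]; ring
      rw [this]
      field_simp
    rw [h3] at h2
    rw [← div_eq_mul_inv, le_div_iff₀ hw, mul_comm]
    exact h2.trans (le_max_left _ _)
  have hX := memXDual_sum_mul hadm.dynamics_weighted hvb
  obtain ⟨C, hC0, hC⟩ := exists_abs_le_of_memXDual hadm hX
  obtain ⟨D, hD0, hD⟩ := exists_bound_of_memLp_top hv
  -- Since `w⁻¹` is bounded, membership in `X*` gives a plain bound, hence integrability along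
  -- trajectories.
  have hbd : ∀ᵐ x ∂volume.restrict Ω, |h x| ≤ C * D := by
    filter_upwards [hC, hD] with x h1 h2
    exact h1.trans (mul_le_mul_of_nonneg_left ((le_abs_self _).trans h2) hC0)
  have hmeas := (hadm.aemeasurable_comp_flow_prod
    (aemeasurable_of_memXDual hadm hX)).aestronglyMeasurable.prodMk_left
  refine ⟨max ω₀ 0, fun t ht => ?_⟩
  filter_upwards [hder.ae hadm.isOpen hadm.boundary hadm.dynamics hadm.isBounded hadm.invariant ht,
    hder.ae_ae hadm.isOpen hadm.boundary hadm.dynamics hadm.isBounded hadm.invariant,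
    hadm.ae_ae_flow hle, hadm.ae_ae_flow hbd, hmeas] with x h1 h2 h3 h4 h5
  rw [h1, mul_comm]
  have hsub : volume.restrict (Ioc 0 t) ≤ volume.restrict (Ioi 0) :=
    Measure.restrict_mono Ioc_subset_Ioi_self le_rfl
  refine gronwall_integral (T := t) (le_max_right _ _) ?_ ?_ (right_mem_Icc.2 ht)
  · refine Integrable.mono' (integrable_const (C * D)) (h5.mono_measure hsub) ?_
    filter_upwards [ae_mono hsub h4] with τ hτ
    exact hτ
  · filter_upwards [ae_mono hsub h2, ae_mono hsub h3] with τ h6 h7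
    rw [← h6]
    exact h7.2

/-- `S(t)φ` is built as a pushforward under `Φᵗ`, by Radon–Nikodym. Without existence, `preadjoint`
would take its default value `0` and stability would say nothing. -/
lemma exists_isPreadjointValue (hadm : IsAdmissible f Ω w) (ht : 0 ≤ t) (hφ : MemX Ω w φ) :
    ∃ ρ, IsPreadjointValue f Ω w t φ ρ := by
  obtain ⟨K, hK⟩ := exists_inv_weight_flow_le_exp hadm
  have hK := hK t ht
  have hwpos := hadm.weight_pos
  have hwf := hadm.ae_flow hwpos ht
  -- The density `φ w² / (w ∘ Φᵗ)` is chosen so that integrating it against `(ψ w) ∘ Φᵗ` gives `⟨φ,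
  -- ψ ∘ Φᵗ⟩`; the growth bound on the weight makes it integrable.
  have hg : Integrable (fun x => φ x * w x * (w x * (w (flow f t x))⁻¹)) (volume.restrict Ω) := by
    refine Integrable.mul_bdd (c := Real.exp (K * t)) hφ ?_ ?_
    · exact (hadm.weight_measurable.mul
        (hadm.aemeasurable_comp_flow ht hadm.weight_measurable.inv)).aestronglyMeasurable
    · filter_upwards [hK, hwpos, hwf] with x h1 h2 h3
      rw [Real.norm_eq_abs, abs_of_pos (mul_pos h2 (inv_pos.2 h3))]
      calc w x * (w (flow f t x))⁻¹ ≤ w x * (Real.exp (K * t) * (w x)⁻¹) :=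
            mul_le_mul_of_nonneg_left h1 h2.le
        _ = Real.exp (K * t) := by field_simp
  obtain ⟨κ, hκ, hκb⟩ := exists_pushforward_density (hadm.aemeasurable_flow ht)
    (hadm.map_flow ht) hg
  refine ⟨fun x => κ x * (w x)⁻¹, ?_, fun ψ hψ => ?_⟩
  · refine hκ.congr ?_
    filter_upwards [hwpos] with x hx
    field_simp
  · have h1 : pairing Ω w (fun x => κ x * (w x)⁻¹) ψ = ∫ x in Ω, κ x * (ψ x * w x) := by
      refine integral_congr_ae ?_
      filter_upwards [hwpos] with x hx
      field_simp
    rw [h1, hκb _ hψ]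
    refine integral_congr_ae ?_
    filter_upwards [hwf] with x hx
    simp only [compositionSemigroup]
    field_simp

lemma isPreadjointValue_preadjoint (hadm : IsAdmissible f Ω w) (ht : 0 ≤ t) (hφ : MemX Ω w φ) :
    IsPreadjointValue f Ω w t φ (preadjoint f Ω w t φ) := by
  have h := exists_isPreadjointValue hadm ht hφ
  rw [preadjoint, dif_pos h]
  exact h.choose_spec

/-- Stability in operator norm on `L¹_w` is turned into a pointwise bound. With `φ = 1_s w⁻¹` and `ψ
= w⁻¹`, the pairing `⟨S(t)φ, ψ⟩` is the integral of `w / (w ∘ Φᵗ)` over `s`, while `‖φ‖_X` is the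
measure of `s` in `Ω`; as `s` is arbitrary, the bound holds almost everywhere. -/
lemma exists_inv_weight_flow_le (hadm : IsAdmissible f Ω w) (hst : ExponentiallyStable f Ω w) :
    ∃ M δ : ℝ, 0 ≤ M ∧ 0 < δ ∧ ∀ t, 0 ≤ t → ∀ᵐ x ∂volume.restrict Ω,
      (w (flow f t x))⁻¹ ≤ M * Real.exp (-δ * t) * (w x)⁻¹ := by
  obtain ⟨M, ω₀, hω₀, hM⟩ := hst
  refine ⟨max M 0, -ω₀, le_max_right _ _, by linarith, fun t ht => ?_⟩
  rw [neg_neg]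
  obtain ⟨K, hK⟩ := exists_inv_weight_flow_le_exp hadm
  have hK := hK t ht
  have hfin : IsFiniteMeasure (volume.restrict Ω) :=
    ⟨by simpa using hadm.isBounded.measure_lt_top⟩
  have hwf := hadm.ae_flow hadm.weight_pos ht
  have hint : Integrable (fun x => w x * (w (flow f t x))⁻¹) (volume.restrict Ω) := by
    refine Integrable.mono' (integrable_const (Real.exp (K * t))) ?_ ?_
    · exact (hadm.weight_measurable.mul
        (hadm.aemeasurable_comp_flow ht hadm.weight_measurable.inv)).aestronglyMeasurable
    · filter_upwards [hK, hadm.weight_pos, hwf] with x h1 h2 h3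
      rw [Real.norm_eq_abs, abs_of_pos (mul_pos h2 (inv_pos.2 h3))]
      calc w x * (w (flow f t x))⁻¹ ≤ w x * (Real.exp (K * t) * (w x)⁻¹) :=
            mul_le_mul_of_nonneg_left h1 h2.le
        _ = Real.exp (K * t) := by field_simp
  have key : (fun x => w x * (w (flow f t x))⁻¹)
      ≤ᵐ[volume.restrict Ω] fun _ => M * Real.exp (ω₀ * t) := by
    refine ae_le_of_forall_setIntegral_le hint (integrable_const _) fun s hs _ => ?_
    have hφw : (fun x => s.indicator (fun x => (w x)⁻¹) x * w x)
        =ᵐ[volume.restrict Ω] s.indicator fun _ => 1 := by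
      filter_upwards [hadm.weight_pos] with x hx
      by_cases hxs : x ∈ s <;> simp [hxs, hx.ne']
    have hφ : MemX Ω w (s.indicator fun x => (w x)⁻¹) :=
      Integrable.congr ((integrable_const (1 : ℝ)).indicator hs) hφw.symm
    obtain ⟨hρ1, hρ2⟩ := isPreadjointValue_preadjoint hadm ht hφ
    have h1 := hρ2 _ (memXDual_inv_weight hadm)
    have h2 := hM t ht _ hφ
    set ρ := preadjoint f Ω w t (s.indicator fun x => (w x)⁻¹)
    have h3 : ∫ x in s, w x * (w (flow f t x))⁻¹ ∂volume.restrict Ω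
        = pairing Ω w (s.indicator fun x => (w x)⁻¹)
          (compositionSemigroup f t fun x => (w x)⁻¹) := by
      rw [← integral_indicator hs]
      refine integral_congr_ae ?_
      filter_upwards [hadm.weight_pos] with x hx
      by_cases hxs : x ∈ s
      · simp only [hxs, indicator_of_mem, compositionSemigroup]
        field_simp
      · simp [hxs]
    have h4 : pairing Ω w ρ (fun x => (w x)⁻¹) ≤ normX Ω w ρ := by
      refine integral_mono_ae ?_ ?_ ?_
      · refine Integrable.congr hρ1 ?_
        filter_upwards [hadm.weight_pos] with x hx
        field_simp
      · refine Integrable.congr hρ1.abs ?_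
        filter_upwards [hadm.weight_pos] with x hx
        rw [abs_mul, abs_of_pos hx]
      · filter_upwards [hadm.weight_pos] with x hx
        have : ρ x * (w x)⁻¹ * w x ^ 2 = ρ x * w x := by field_simp
        rw [this]
        exact mul_le_mul_of_nonneg_right (le_abs_self _) hx.le
    have h5 : normX Ω w (s.indicator fun x => (w x)⁻¹) = ∫ _ in s, (1 : ℝ) ∂volume.restrict Ω := by
      rw [← integral_indicator hs]
      refine integral_congr_ae ?_
      filter_upwards [hφw, hadm.weight_pos] with x hx hw
      rw [← hx]
      by_cases hxs : x ∈ s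
      · simp [hxs, abs_of_pos hw]
      · simp [hxs]
    have h6 : ∫ _ in s, M * Real.exp (ω₀ * t) ∂volume.restrict Ω
        = M * Real.exp (ω₀ * t) * ∫ _ in s, (1 : ℝ) ∂volume.restrict Ω := by
      rw [← integral_const_mul, mul_one]
    rw [h3, ← h1, h6, ← h5]
    exact h4.trans h2
  filter_upwards [key, hadm.weight_pos] with x h1 h2
  have h3 : w x * (w (flow f t x))⁻¹ ≤ max M 0 * Real.exp (ω₀ * t) :=
    h1.trans (mul_le_mul_of_nonneg_right (le_max_left _ _) (Real.exp_pos _).le)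
  rwa [← div_eq_mul_inv, le_div_iff₀ h2, mul_comm]

lemma exists_abs_comp_flow_le (hadm : IsAdmissible f Ω w) {M δ : ℝ}
    (hM : ∀ t, 0 ≤ t → ∀ᵐ x ∂volume.restrict Ω,
      (w (flow f t x))⁻¹ ≤ M * Real.exp (-δ * t) * (w x)⁻¹) (hu : MemXDual Ω w u) :
    ∃ C, 0 ≤ C ∧ ∀ t, 0 ≤ t → ∀ᵐ x ∂volume.restrict Ω,
      |u (flow f t x)| ≤ C * M * (w x)⁻¹ * Real.exp (-δ * t) := by
  obtain ⟨C, hC, hCu⟩ := exists_abs_le_of_memXDual hadm hu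
  refine ⟨C, hC, fun t ht => ?_⟩
  filter_upwards [hadm.ae_flow hCu ht, hM t ht] with x h1 h2
  calc |u (flow f t x)| ≤ C * (w (flow f t x))⁻¹ := h1
    _ ≤ C * (M * Real.exp (-δ * t) * (w x)⁻¹) := mul_le_mul_of_nonneg_left h2 hC
    _ = _ := by ring

lemma ae_prod_abs_comp_flow_le (hadm : IsAdmissible f Ω w) {C δ : ℝ}
    (hu : AEMeasurable u (volume.restrict Ω))
    (h : ∀ t, 0 ≤ t → ∀ᵐ x ∂volume.restrict Ω,
      |u (flow f t x)| ≤ C * (w x)⁻¹ * Real.exp (-δ * t)) :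
    ∀ᵐ p ∂(volume.restrict Ω).prod (volume.restrict (Ioi (0 : ℝ))),
      |u (flow f p.2 p.1)| ≤ C * (w p.1)⁻¹ * Real.exp (-δ * p.2) := by
  have hexp : Measurable fun p : EuclideanSpace ℝ (Fin d) × ℝ => Real.exp (-δ * p.2) := by
    fun_prop
  refine ae_prod_of_ae_ae (nullMeasurableSet_le (hadm.aemeasurable_comp_flow_prod hu).abs
    ((hadm.weight_measurable.inv.const_mul C).comp_fst.mul hexp.aemeasurable)) ?_
  filter_upwards [ae_restrict_mem measurableSet_Ioi] with t ht
  exact h t (le_of_lt ht)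

end Semigroup

/-! ### Laguerre functions and their differential operator -/

section LaguerreFunction

/-- The function `t ↦ P(t) e^{-t/2}`. -/
noncomputable def expPoly (P : ℝ[X]) (t : ℝ) : ℝ := P.eval t * Real.exp (-t / 2)

/-- The operator on polynomials corresponding to the derivative of `P(t) e^{-t/2}`. -/
noncomputable def expPolyDeriv (P : ℝ[X]) : ℝ[X] :=
  Polynomial.derivative P - Polynomial.C (1 / 2) * P

lemma expPoly_add (P Q : ℝ[X]) (t : ℝ) : expPoly (P + Q) t = expPoly P t + expPoly Q t := by
  simp [expPoly, add_mul]

lemma expPoly_mul (P Q : ℝ[X]) (t : ℝ) : expPoly (P * Q) t = P.eval t * expPoly Q t := by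
  simp [expPoly, mul_assoc]

lemma continuous_expPoly (P : ℝ[X]) : Continuous (expPoly P) := by
  unfold expPoly
  fun_prop

lemma hasDerivAt_expPoly (P : ℝ[X]) (t : ℝ) :
    HasDerivAt (expPoly P) (expPoly (expPolyDeriv P) t) t := by
  have h1 : HasDerivAt (fun t : ℝ => Real.exp (-t / 2)) (Real.exp (-t / 2) * (-1 / 2)) t :=
    ((hasDerivAt_id t).neg.div_const 2).exp
  refine ((P.hasDerivAt t).mul h1).congr_deriv ?_
  simp [expPoly, expPolyDeriv]
  ring

/-- Polynomial factors produced by the Laguerre operator are absorbed by an arbitrarily small part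
of the exponential decay. -/
lemma exists_abs_eval_le (P : ℝ[X]) {δ : ℝ} (hδ : 0 < δ) :
    ∃ C, 0 ≤ C ∧ ∀ t, 0 ≤ t → |P.eval t| ≤ C * Real.exp (δ * t) := by
  have h1 : Tendsto (fun t : ℝ => P.eval t / Real.exp (δ * t)) atTop (𝓝 0) := by
    have h := (P.comp (Polynomial.C δ⁻¹ * Polynomial.X)).tendsto_div_exp_atTop.comp
      (tendsto_id.const_mul_atTop hδ)
    refine h.congr fun t => ?_
    simp [hδ.ne']
  have hc : Continuous fun t : ℝ => P.eval t / Real.exp (δ * t) :=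
    P.continuous.div (by fun_prop) fun t => (Real.exp_pos _).ne'
  obtain ⟨T, hT⟩ := eventually_atTop.1 (h1.abs.eventually (gt_mem_nhds (show |(0 : ℝ)| < 1 by simp)))
  obtain ⟨C, hC⟩ := (isCompact_Icc (a := (0 : ℝ)) (b := T)).exists_bound_of_continuousOn
    hc.continuousOn
  refine ⟨max C 1, le_max_of_le_right zero_le_one, fun t ht => ?_⟩
  have h2 : |P.eval t / Real.exp (δ * t)| ≤ max C 1 := by
    rcases le_total t T with h | h
    · exact (hC t ⟨ht, h⟩).trans (le_max_left _ _)
    · exact (hT t h).le.trans (le_max_right _ _)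
  rwa [abs_div, abs_of_pos (Real.exp_pos _), div_le_iff₀ (Real.exp_pos _)] at h2

lemma exists_abs_expPoly_le (P : ℝ[X]) :
    ∃ C, 0 ≤ C ∧ ∀ t, 0 ≤ t → |expPoly P t| ≤ C * Real.exp (-(1 / 4) * t) := by
  obtain ⟨C, hC, h⟩ := exists_abs_eval_le P (δ := 1 / 4) (by norm_num)
  refine ⟨C, hC, fun t ht => ?_⟩
  rw [expPoly, abs_mul, abs_of_pos (Real.exp_pos _)]
  calc |P.eval t| * Real.exp (-t / 2) ≤ C * Real.exp (1 / 4 * t) * Real.exp (-t / 2) :=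
        mul_le_mul_of_nonneg_right (h t ht) (Real.exp_pos _).le
    _ = C * Real.exp (-(1 / 4) * t) := by
        rw [mul_assoc, ← Real.exp_add]
        ring_nf

lemma integrableOn_exp_neg {δ : ℝ} (hδ : 0 < δ) :
    IntegrableOn (fun t => Real.exp (-δ * t)) (Ioi (0 : ℝ)) volume :=
  integrableOn_exp_mul_Ioi (by linarith) 0

lemma integrable_of_abs_le_exp {u : ℝ → ℝ} {B δ : ℝ} (hδ : 0 < δ)
    (hu : AEStronglyMeasurable u (volume.restrict (Ioi 0)))
    (h : ∀ᵐ t ∂volume.restrict (Ioi (0 : ℝ)), |u t| ≤ B * Real.exp (-δ * t)) :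
    Integrable u (volume.restrict (Ioi 0)) :=
  Integrable.mono' (Integrable.const_mul (integrableOn_exp_neg hδ) B) hu h

lemma memLp_two_of_abs_le_exp {u : ℝ → ℝ} {B δ : ℝ} (hδ : 0 < δ)
    (hu : AEStronglyMeasurable u (volume.restrict (Ioi 0)))
    (h : ∀ᵐ t ∂volume.restrict (Ioi (0 : ℝ)), |u t| ≤ B * Real.exp (-δ * t)) :
    MemLp u 2 (volume.restrict (Ioi 0)) := by
  rw [memLp_two_iff_integrable_sq hu]
  refine integrable_of_abs_le_exp (B := B ^ 2) (δ := 2 * δ) (by linarith) (hu.pow 2) ?_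
  filter_upwards [h] with t ht
  rw [abs_pow]
  calc |u t| ^ 2 ≤ (B * Real.exp (-δ * t)) ^ 2 := pow_le_pow_left₀ (abs_nonneg _) ht 2
    _ = B ^ 2 * Real.exp (-(2 * δ) * t) := by
        rw [mul_pow, ← Real.exp_nat_mul]
        ring_nf

lemma integral_sq_le_of_abs_le_exp {u : ℝ → ℝ} {B δ : ℝ} (hδ : 0 < δ)
    (hu : AEStronglyMeasurable u (volume.restrict (Ioi 0)))
    (h : ∀ᵐ t ∂volume.restrict (Ioi (0 : ℝ)), |u t| ≤ B * Real.exp (-δ * t)) :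
    ∫ t in Ioi 0, u t ^ 2 ≤ B ^ 2 * ∫ t in Ioi (0 : ℝ), Real.exp (-(2 * δ) * t) := by
  rw [← integral_const_mul]
  refine integral_mono_ae ((memLp_two_iff_integrable_sq hu).1 (memLp_two_of_abs_le_exp hδ hu h))
    (Integrable.const_mul (integrableOn_exp_neg (by linarith)) _) ?_
  filter_upwards [h] with t ht
  calc u t ^ 2 = |u t| ^ 2 := (sq_abs _).symm
    _ ≤ (B * Real.exp (-δ * t)) ^ 2 := pow_le_pow_left₀ (abs_nonneg _) ht 2
    _ = B ^ 2 * Real.exp (-(2 * δ) * t) := by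
        rw [mul_pow, ← Real.exp_nat_mul]
        ring_nf

lemma memLp_expPoly (P : ℝ[X]) : MemLp (expPoly P) 2 (volume.restrict (Ioi 0)) := by
  obtain ⟨C, hC, h⟩ := exists_abs_expPoly_le P
  refine memLp_two_of_abs_le_exp (B := C) (δ := 1 / 4) (by norm_num)
    (continuous_expPoly P).aestronglyMeasurable ?_
  filter_upwards [ae_restrict_mem measurableSet_Ioi] with t ht
  exact h t (le_of_lt ht)

lemma integrable_expPoly (P : ℝ[X]) : Integrable (expPoly P) (volume.restrict (Ioi 0)) := by
  obtain ⟨C, hC, h⟩ := exists_abs_expPoly_le P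
  refine integrable_of_abs_le_exp (B := C) (δ := 1 / 4) (by norm_num)
    (continuous_expPoly P).aestronglyMeasurable ?_
  filter_upwards [ae_restrict_mem measurableSet_Ioi] with t ht
  exact h t (le_of_lt ht)

lemma tendsto_expPoly_atTop (P : ℝ[X]) : Tendsto (expPoly P) atTop (𝓝 0) := by
  obtain ⟨C, hC, h⟩ := exists_abs_expPoly_le P
  have h2 : Tendsto (fun t : ℝ => C * Real.exp (-(1 / 4) * t)) atTop (𝓝 0) := by
    have h3 : Tendsto (fun t : ℝ => -(1 / 4) * t) atTop atBot :=
      tendsto_id.const_mul_atTop_of_neg (by norm_num)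
    simpa using (Real.tendsto_exp_atBot.comp h3).const_mul C
  refine squeeze_zero_norm' ?_ h2
  filter_upwards [eventually_ge_atTop 0] with t ht
  exact h t ht

lemma integral_Ioi_expPolyDeriv (P : ℝ[X]) (s : ℝ) (hs : 0 ≤ s) :
    ∫ t in Ioi s, expPoly (expPolyDeriv P) t = -expPoly P s := by
  have h := integral_Ioi_of_hasDerivAt_of_tendsto' (a := s) (m := 0)
    (fun t _ => hasDerivAt_expPoly P t)
    ((integrable_expPoly (expPolyDeriv P)).mono_measure
      (Measure.restrict_mono (Ioi_subset_Ioi hs) le_rfl)) (tendsto_expPoly_atTop P)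
  rw [h, zero_sub]

/-- Integration by parts against `P(t) e^{-t/2}` for a function that is almost everywhere equal
to a primitive. -/
lemma integral_mul_expPolyDeriv {u u' : ℝ → ℝ} {a B δ : ℝ} (hδ : 0 < δ)
    (hm : AEStronglyMeasurable u' (volume.restrict (Ioi 0)))
    (hB : ∀ᵐ t ∂volume.restrict (Ioi (0 : ℝ)), |u' t| ≤ B * Real.exp (-δ * t))
    (hu : ∀ᵐ t ∂volume.restrict (Ioi (0 : ℝ)), u t = a + ∫ s in 0..t, u' s)
    {P : ℝ[X]} (hP : P.eval 0 = 0) :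
    ∫ t in Ioi 0, u t * expPoly (expPolyDeriv P) t = -∫ t in Ioi 0, u' t * expPoly P t := by
  set φ' := expPoly (expPolyDeriv P) with hφ'
  have hφi : Integrable φ' (volume.restrict (Ioi 0)) := integrable_expPoly _
  have hui : Integrable u' (volume.restrict (Ioi 0)) := integrable_of_abs_le_exp hδ hm hB
  have h0 : ∫ t in Ioi 0, φ' t = 0 := by
    rw [integral_Ioi_expPolyDeriv P 0 le_rfl]
    simp [expPoly, hP]
  -- Integration by parts as Fubini on the triangle `s ≤ t`, which needs no regularity of `u'`. The
  -- constant `a` drops out because `φ'` has integral `0`, by `P(0) = 0`.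
  set F : ℝ × ℝ → ℝ := {p : ℝ × ℝ | p.2 ≤ p.1}.indicator fun p => φ' p.1 * u' p.2 with hF
  have hFi : Integrable F ((volume.restrict (Ioi 0)).prod (volume.restrict (Ioi 0))) :=
    (hφi.mul_prod hui).indicator (measurableSet_le measurable_snd measurable_fst)
  have h1 : ∀ t, 0 < t → ∫ s in Ioi 0, F (t, s) = φ' t * ∫ s in 0..t, u' s := by
    intro t ht
    have : (fun s => F (t, s)) = (Iic t).indicator fun s => φ' t * u' s := by
      ext s
      by_cases h : s ≤ t <;> simp [hF, h]
    rw [this, setIntegral_indicator measurableSet_Iic, Ioi_inter_Iic, integral_const_mul,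
      intervalIntegral.integral_of_le ht.le]
  have h2 : ∀ s, 0 < s → ∫ t in Ioi 0, F (t, s) = -(u' s * expPoly P s) := by
    intro s hs
    have : (fun t => F (t, s)) = (Ici s).indicator fun t => φ' t * u' s := by
      ext t
      by_cases h : s ≤ t <;> simp [hF, h]
    have hinter : Ioi 0 ∩ Ici s = Ici s := inter_eq_right.2 fun t ht => lt_of_lt_of_le hs ht
    rw [this, setIntegral_indicator measurableSet_Ici,
      hinter, integral_mul_const,
      integral_Ici_eq_integral_Ioi, integral_Ioi_expPolyDeriv P s hs.le]
    ring
  have h3 : ∫ t in Ioi 0, u t * φ' t = ∫ t in Ioi 0, (a * φ' t + ∫ s in Ioi 0, F (t, s)) := by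
    refine integral_congr_ae ?_
    filter_upwards [hu, ae_restrict_mem measurableSet_Ioi] with t ht ht0
    rw [h1 t ht0, ht]
    ring
  rw [h3, integral_add (hφi.const_mul a) hFi.integral_prod_left, integral_const_mul, h0, mul_zero,
    zero_add, integral_integral_swap (f := fun t s => F (t, s)) hFi, ← integral_neg]
  refine integral_congr_ae ?_
  filter_upwards [ae_restrict_mem measurableSet_Ioi] with s hs
  exact h2 s hs

/-- The coefficients of the Laguerre polynomials. -/
noncomputable def laguerreCoeff (n k : ℕ) : ℝ := (-1) ^ k * (n.choose k : ℝ) / (k.factorial : ℝ)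

/-- The Laguerre polynomials. -/
noncomputable def laguerre (n : ℕ) : ℝ[X] :=
  ∑ k ∈ Finset.range (n + 1), Polynomial.monomial k (laguerreCoeff n k)

lemma coeff_laguerre (n k : ℕ) : (laguerre n).coeff k = laguerreCoeff n k := by
  simp only [laguerre, Polynomial.finsetSum_coeff, Polynomial.coeff_monomial,
    Finset.sum_ite_eq', Finset.mem_range]
  split_ifs with h
  · rfl
  · rw [laguerreCoeff, Nat.choose_eq_zero_of_lt (by omega)]
    simp

lemma degree_laguerre (n : ℕ) : (laguerre n).degree = n := by
  refine Polynomial.degree_eq_of_le_of_coeff_ne_zero ?_ ?_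
  · rw [Polynomial.degree_le_iff_coeff_zero]
    intro k hk
    rw [coeff_laguerre, laguerreCoeff, Nat.choose_eq_zero_of_lt (by exact_mod_cast hk)]
    simp
  · rw [coeff_laguerre, laguerreCoeff]
    simp [Nat.factorial_ne_zero]

/-- This recursion is the Laguerre equation `tL'' + (1 - t)L' + nL = 0` read coefficient by
coefficient. -/
lemma laguerreCoeff_succ (n k : ℕ) :
    ((k : ℝ) + 1) ^ 2 * laguerreCoeff n (k + 1) = -((n : ℝ) - k) * laguerreCoeff n k := by
  have h : (n.choose (k + 1) : ℝ) * ((k : ℝ) + 1) = (n.choose k : ℝ) * ((n : ℝ) - k) := by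
    rcases le_or_gt k n with hk | hk
    · have := Nat.choose_succ_right_eq n k
      rw [← Nat.cast_sub hk]
      exact_mod_cast this
    · rw [Nat.choose_eq_zero_of_lt hk, Nat.choose_eq_zero_of_lt (by omega)]
      simp
  have hf : (k.factorial : ℝ) ≠ 0 := by exact_mod_cast Nat.factorial_ne_zero k
  have hk : (k : ℝ) + 1 ≠ 0 := by positivity
  simp only [laguerreCoeff, Nat.factorial_succ, Nat.cast_mul, Nat.cast_succ, pow_succ]
  field_simp
  linear_combination -h

lemma laguerre_ode (n : ℕ) :
    Polynomial.X * Polynomial.derivative (Polynomial.derivative (laguerre n))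
      + (1 - Polynomial.X) * Polynomial.derivative (laguerre n)
      + Polynomial.C (n : ℝ) * laguerre n = 0 := by
  ext k
  have h := laguerreCoeff_succ n k
  rw [sub_mul, one_mul]
  cases k with
  | zero =>
    simp only [Polynomial.coeff_add, Polynomial.coeff_sub, Polynomial.coeff_derivative,
      coeff_laguerre, Polynomial.coeff_zero, Polynomial.mul_coeff_zero, Polynomial.coeff_X_zero,
      Polynomial.coeff_C_zero]
    push_cast at h ⊢
    linear_combination h
  | succ k =>
    simp only [Polynomial.coeff_add, Polynomial.coeff_sub, Polynomial.coeff_C_mul,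
      Polynomial.coeff_X_mul, Polynomial.coeff_derivative, coeff_laguerre, Polynomial.coeff_zero]
    push_cast at h ⊢
    linear_combination h

lemma expPolyDeriv_mul (P Q : ℝ[X]) :
    expPolyDeriv (P * Q) = Polynomial.derivative P * Q + P * expPolyDeriv Q := by
  simp only [expPolyDeriv, Polynomial.derivative_mul]
  ring

/-- The Laguerre equation in self-adjoint form: after multiplication by `e^{-t/2}`, it says that `t
u / 4 - (t u')'` has eigenvalue `n + 1/2`. -/
lemma laguerre_eigen (n : ℕ) :
    Polynomial.C ((n : ℝ) + 1 / 2) * laguerre n = Polynomial.C (1 / 4) * Polynomial.X * laguerre n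
      - expPolyDeriv (Polynomial.X * expPolyDeriv (laguerre n)) := by
  have h := laguerre_ode n
  have h4 : (Polynomial.C (1 / 4) : ℝ[X]) = Polynomial.C (1 / 2) * Polynomial.C (1 / 2) := by
    rw [← Polynomial.C_mul]
    norm_num
  have h2 : (Polynomial.C (1 / 2) : ℝ[X]) + Polynomial.C (1 / 2) = 1 := by
    rw [← Polynomial.C_add]
    norm_num
  rw [Polynomial.C_add, h4]
  simp only [expPolyDeriv, Polynomial.derivative_mul, Polynomial.derivative_sub,
    Polynomial.derivative_X, Polynomial.derivative_C]
  linear_combination h - Polynomial.X * Polynomial.derivative (laguerre n) * h2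

/-- The functions `u 0, …, u m` decay exponentially and each is the derivative of its
predecessor. -/
structure IsDecayingChain (B δ : ℝ) (m : ℕ) (u : ℕ → ℝ → ℝ) : Prop where
  meas : ∀ j ≤ m, AEStronglyMeasurable (u j) (volume.restrict (Ioi 0))
  bound : ∀ j ≤ m, ∀ᵐ t ∂volume.restrict (Ioi (0 : ℝ)), |u j t| ≤ B * Real.exp (-δ * t)
  prim : ∀ j < m, ∃ a, ∀ᵐ t ∂volume.restrict (Ioi (0 : ℝ)), u j t = a + ∫ s in 0..t, u (j + 1) s

variable {B δ : ℝ} {m : ℕ} {u : ℕ → ℝ → ℝ}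

lemma IsDecayingChain.integrable_mul (hu : IsDecayingChain B δ m u) (hδ : 0 < δ) {j : ℕ}
    (hj : j ≤ m) (P : ℝ[X]) :
    Integrable (fun t => u j t * expPoly P t) (volume.restrict (Ioi 0)) :=
  (memLp_two_of_abs_le_exp hδ (hu.meas j hj) (hu.bound j hj)).integrable_mul (memLp_expPoly P)

lemma IsDecayingChain.integral_add (hu : IsDecayingChain B δ m u) (hδ : 0 < δ) {j : ℕ}
    (hj : j ≤ m) (P Q : ℝ[X]) :
    ∫ t in Ioi 0, u j t * expPoly (P + Q) t
      = (∫ t in Ioi 0, u j t * expPoly P t) + ∫ t in Ioi 0, u j t * expPoly Q t := by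
  rw [← MeasureTheory.integral_add (hu.integrable_mul hδ hj P) (hu.integrable_mul hδ hj Q)]
  simp only [expPoly_add, mul_add]

lemma integral_mul_expPoly_C_mul (v : ℝ → ℝ) (c : ℝ) (P : ℝ[X]) :
    ∫ t in Ioi 0, v t * expPoly (Polynomial.C c * P) t = c * ∫ t in Ioi 0, v t * expPoly P t := by
  rw [← integral_const_mul]
  refine integral_congr_ae (.of_forall fun t => ?_)
  simp only [expPoly_mul, Polynomial.eval_C]
  ring

lemma IsDecayingChain.integral_deriv (hu : IsDecayingChain B δ m u) (hδ : 0 < δ) {j : ℕ}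
    (hj : j < m) (Q : ℝ[X]) :
    ∫ t in Ioi 0, u j t * expPoly (expPolyDeriv (Polynomial.X * Q)) t
      = -∫ t in Ioi 0, u (j + 1) t * expPoly (Polynomial.X * Q) t := by
  obtain ⟨a, ha⟩ := hu.prim j hj
  exact integral_mul_expPolyDeriv hδ (hu.meas _ hj) (hu.bound _ hj) ha (by simp)

/-- The Laguerre operator is symmetric; here it acts on `P u_j`. -/
lemma IsDecayingChain.laguerre_symm (hu : IsDecayingChain B δ m u) (hδ : 0 < δ) {j : ℕ}
    (hj : j + 2 ≤ m) (P : ℝ[X]) (n : ℕ) :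
    ((n : ℝ) + 1 / 2) * ∫ t in Ioi 0, u j t * expPoly (P * laguerre n) t
      = (∫ t in Ioi 0, u j t * expPoly ((Polynomial.C (1 / 4) * Polynomial.X * P
          - Polynomial.derivative (Polynomial.X * Polynomial.derivative P)) * laguerre n) t)
        + (∫ t in Ioi 0, u (j + 1) t * expPoly (-(Polynomial.derivative (Polynomial.X * P)
          + Polynomial.X * Polynomial.derivative P) * laguerre n) t)
        + ∫ t in Ioi 0, u (j + 2) t * expPoly (-(Polynomial.X * P) * laguerre n) t := by
  set L := laguerre n with hL
  set X : ℝ[X] := Polynomial.X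
  set P' := Polynomial.derivative P with hP'
  have hneg : ∀ (v : ℝ → ℝ) (Q : ℝ[X]), ∫ t in Ioi 0, v t * expPoly (-Q) t
      = -∫ t in Ioi 0, v t * expPoly Q t := by
    intro v Q
    have := integral_mul_expPoly_C_mul v (-1) Q
    simpa using this
  -- The factor `P` is carried under the derivatives so that each derived term has the shape
  -- `expPolyDeriv (X * _)`: the factor `X` makes integration by parts free of boundary terms.
  have e1 : Polynomial.C ((n : ℝ) + 1 / 2) * (P * L)
      = (Polynomial.C (1 / 4) * X * P - Polynomial.derivative (X * P')) * L
        + (-(expPolyDeriv (X * (P * expPolyDeriv L))) + expPolyDeriv (X * (P' * L))) := by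
    have h1 := laguerre_eigen n
    have h2 : expPolyDeriv (X * (P * expPolyDeriv L))
        = P' * (X * expPolyDeriv L) + P * expPolyDeriv (X * expPolyDeriv L) := by
      rw [show X * (P * expPolyDeriv L) = P * (X * expPolyDeriv L) by ring, expPolyDeriv_mul]
    have h3 : expPolyDeriv (X * (P' * L))
        = Polynomial.derivative (X * P') * L + X * P' * expPolyDeriv L := by
      rw [← mul_assoc, expPolyDeriv_mul]
    rw [h2, h3]
    linear_combination P * h1
  have e2 : X * (P * expPolyDeriv L)
      = expPolyDeriv (X * (P * L)) + -(Polynomial.derivative (X * P) * L) := by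
    rw [← mul_assoc X P L, expPolyDeriv_mul]
    ring
  rw [← integral_mul_expPoly_C_mul, e1, hu.integral_add hδ (by omega),
    hu.integral_add hδ (by omega), hneg, hu.integral_deriv hδ (by omega),
    hu.integral_deriv hδ (by omega)]
  have e3 : -(Polynomial.derivative (X * P) + X * P') * L
      = -(Polynomial.derivative (X * P) * L) + -(X * (P' * L)) := by ring
  have e4 : -(X * P) * L = -(X * (P * L)) := by ring
  rw [e3, hu.integral_add hδ (by omega), e4, e2, hu.integral_add hδ (by omega), hneg, hneg, hneg,
    hu.integral_deriv hδ (by omega)]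
  ring

/-- The sum on the right is `A^q u₀` tested against a Laguerre function, for `Au = t u / 4 - (t
u')'`. The orders `j` and polynomials `P` are fixed before `u`, which makes later constants uniform
over trajectories. -/
lemma exists_laguerre_pow_representation (q : ℕ) :
    ∃ (ι : Type) (_ : Fintype ι) (j : ι → ℕ) (P : ι → ℝ[X]), (∀ i, j i ≤ 2 * q) ∧
      ∀ (B δ : ℝ) (u : ℕ → ℝ → ℝ), 0 < δ → IsDecayingChain B δ (2 * q) u → ∀ n : ℕ,
        ((n : ℝ) + 1 / 2) ^ q * ∫ t in Ioi 0, u 0 t * expPoly (laguerre n) t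
          = ∑ i, ∫ t in Ioi 0, u (j i) t * expPoly (P i * laguerre n) t := by
  induction q with
  | zero => exact ⟨Unit, inferInstance, fun _ => 0, fun _ => 1, by simp, by simp⟩
  | succ q ih =>
    obtain ⟨ι, _, j, P, hj, h⟩ := ih
    -- One more application of the operator splits each term into three, raising the order of the
    -- derivative by `0`, `1` or `2`.
    refine ⟨ι × Fin 3, inferInstance, fun i => j i.1 + i.2, fun i =>
      ![Polynomial.C (1 / 4) * Polynomial.X * P i.1
          - Polynomial.derivative (Polynomial.X * Polynomial.derivative (P i.1)),
        -(Polynomial.derivative (Polynomial.X * P i.1)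
          + Polynomial.X * Polynomial.derivative (P i.1)),
        -(Polynomial.X * P i.1)] i.2, fun i => ?_, fun B δ u hδ hu n => ?_⟩
    · change j i.1 + (i.2 : ℕ) ≤ _
      have h1 := hj i.1
      have h2 := i.2.2
      omega
    · have hu' : IsDecayingChain B δ (2 * q) u :=
        ⟨fun j hj => hu.meas j (by omega), fun j hj => hu.bound j (by omega),
          fun j hj => hu.prim j (by omega)⟩
      rw [pow_succ', mul_assoc, h B δ u hδ hu' n, Finset.mul_sum, Fintype.sum_prod_type]
      refine Finset.sum_congr rfl fun i _ => ?_
      rw [hu.laguerre_symm hδ (by have := hj i; omega), Fin.sum_univ_three]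
      simp

end LaguerreFunction

/-! ### Completeness, Parseval and decay of Laguerre coefficients -/

section LaguerreBasis

open ProbabilityTheory in
/-- A measure with some exponential moments is determined by its moments. -/
lemma measure_eq_of_moments_eq {μ ν : Measure ℝ} [IsFiniteMeasure μ] [IsFiniteMeasure ν]
    (hμ : 0 ∈ interior (integrableExpSet id μ)) (hν : 0 ∈ interior (integrableExpSet id ν))
    (h : ∀ n : ℕ, ∫ x, x ^ n ∂μ = ∫ x, x ^ n ∂ν) : μ = ν := by
  have h0 : ∀ (ρ : Measure ℝ), 0 ∈ interior (integrableExpSet id ρ) →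
      ∀ n : ℕ, iteratedDeriv n (complexMGF id ρ) 0 = ((∫ x, x ^ n ∂ρ : ℝ) : ℂ) := by
    intro ρ hρ n
    rw [iteratedDeriv_complexMGF (by simpa using hρ), ← integral_complex_ofReal]
    simp
  have hs := ((analyticAt_complexMGF (X := id) (μ := μ) (z := 0)
    (by simpa using hμ)).hasFPowerSeriesAt).sub
    ((analyticAt_complexMGF (X := id) (μ := ν) (z := 0) (by simpa using hν)).hasFPowerSeriesAt)
  have hev : complexMGF id μ =ᶠ[𝓝 0] complexMGF id ν := by
    simp only [h0 μ hμ, h0 ν hν, h, sub_self] at hs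
    filter_upwards [hs.eventually_eq_zero] with z hz
    exact sub_eq_zero.1 hz
  -- Equal moments give equal Taylor series at `0`; the identity theorem spreads the equality over a
  -- vertical strip containing the imaginary axis, where the characteristic functions live.
  set U : Set ℂ := {z | z.re ∈ interior (integrableExpSet id μ) ∩ interior (integrableExpSet id ν)}
  have hU : IsPreconnected U :=
    ((convex_integrableExpSet.interior.inter convex_integrableExpSet.interior).linear_preimage
      Complex.reLm).isPreconnected
  have hEq : EqOn (complexMGF id μ) (complexMGF id ν) U :=
    (analyticOnNhd_complexMGF.mono fun z hz => hz.1).eqOn_of_preconnected_of_eventuallyEq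
      (analyticOnNhd_complexMGF.mono fun z hz => hz.2) hU (z₀ := 0) ⟨by simpa using hμ,
        by simpa using hν⟩ hev
  refine Measure.ext_of_charFun (funext fun t => ?_)
  rw [← complexMGF_id_mul_I, ← complexMGF_id_mul_I]
  exact hEq ⟨by simpa using hμ, by simpa using hν⟩

open ProbabilityTheory in
/-- A square integrable function orthogonal to all functions `P(t) e^{-t/2}` vanishes. -/
lemma ae_eq_zero_of_integral_mul_expPoly {f : ℝ → ℝ} (hf : MemLp f 2 (volume.restrict (Ioi 0)))
    (h : ∀ P, ∫ t in Ioi 0, f t * expPoly P t = 0) : f =ᵐ[volume.restrict (Ioi 0)] 0 := by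
  have hexp : ∀ a < (1 / 2 : ℝ), Integrable (fun t => f t * Real.exp (-t / 2) * Real.exp (a * t))
      (volume.restrict (Ioi 0)) := by
    intro a ha
    have h1 : MemLp (fun t : ℝ => Real.exp (-t / 2) * Real.exp (a * t)) 2
        (volume.restrict (Ioi 0)) := by
      refine memLp_two_of_abs_le_exp (B := 1) (δ := 1 / 2 - a) (by linarith)
        (by fun_prop) (.of_forall fun t => ?_)
      rw [← Real.exp_add, abs_of_pos (Real.exp_pos _), one_mul]
      apply le_of_eq
      ring_nf
    simpa only [mul_assoc] using! hf.integrable_mul h1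
  set g : ℝ → ℝ := fun t => f t * Real.exp (-t / 2) with hg
  have hgi : Integrable g (volume.restrict (Ioi 0)) := by simpa using hexp 0 (by norm_num)
  have hm : AEMeasurable g (volume.restrict (Ioi 0)) := hgi.1.aemeasurable
  have key : ∀ g' : ℝ → ℝ, Integrable g' (volume.restrict (Ioi 0)) → (∀ t, |g' t| = |g t|) →
      0 ∈ interior (integrableExpSet id
        ((volume.restrict (Ioi 0)).withDensity fun t => ENNReal.ofReal (g' t))) := by
    intro g' hg' hle
    rw [mem_interior_iff_mem_nhds]
    filter_upwards [Iio_mem_nhds (show (0 : ℝ) < 1 / 2 by norm_num)] with a ha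
    change Integrable _ _
    rw [integrable_withDensity_iff_integrable_smul₀' hg'.1.aemeasurable.ennreal_ofReal
      (.of_forall fun t => ENNReal.ofReal_lt_top)]
    refine (hexp a ha).mono (hg'.1.aemeasurable.ennreal_ofReal.ennreal_toReal.smul
      (by fun_prop)).aestronglyMeasurable (.of_forall fun t => ?_)
    rw [norm_smul, norm_mul]
    refine mul_le_mul_of_nonneg_right ?_ (norm_nonneg _)
    change ‖_‖ ≤ ‖g t‖
    rw [Real.norm_eq_abs, Real.norm_eq_abs, ← hle t, ENNReal.toReal_ofReal',
      abs_of_nonneg (le_max_right _ _)]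
    exact max_le (le_abs_self _) (abs_nonneg _)
  have hint : ∀ n : ℕ, Integrable (fun t => g t * t ^ n) (volume.restrict (Ioi 0)) := by
    intro n
    refine (hf.integrable_mul (memLp_expPoly (Polynomial.X ^ n))).congr (.of_forall fun t => ?_)
    simp only [Pi.mul_apply, expPoly, Polynomial.eval_pow, Polynomial.eval_X, hg]
    ring
  have := isFiniteMeasure_withDensity_ofReal hgi.2
  have := isFiniteMeasure_withDensity_ofReal hgi.neg.2
  -- Orthogonality to `tⁿ e^{-t/2}` says that the positive and negative parts of `g`, taken as
  -- densities, have equal moments.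
  have heq := measure_eq_of_moments_eq (key g hgi fun t => rfl)
    (key (-g) hgi.neg fun t => by simp) fun n => by
      rw [integral_withDensity_eq_integral_toReal_smul₀ hm.ennreal_ofReal
          (.of_forall fun t => ENNReal.ofReal_lt_top),
        integral_withDensity_eq_integral_toReal_smul₀ hm.neg.ennreal_ofReal
          (.of_forall fun t => ENNReal.ofReal_lt_top), ← sub_eq_zero, ← integral_sub]
      · refine Eq.trans ?_ (h (Polynomial.X ^ n))
        refine integral_congr_ae (.of_forall fun t => ?_)
        simp only [smul_eq_mul, ENNReal.toReal_ofReal', ← sub_mul, Pi.neg_apply,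
          max_zero_sub_max_neg_zero_eq_self, hg, expPoly, Polynomial.eval_pow, Polynomial.eval_X]
        ring
      · refine (hint n).mono (hm.ennreal_ofReal.ennreal_toReal.smul
          (by fun_prop)).aestronglyMeasurable (.of_forall fun t => ?_)
        rw [norm_smul, norm_mul]
        refine mul_le_mul_of_nonneg_right ?_ (norm_nonneg _)
        rw [Real.norm_eq_abs, Real.norm_eq_abs, ENNReal.toReal_ofReal',
          abs_of_nonneg (le_max_right _ _)]
        exact max_le (le_abs_self _) (abs_nonneg _)
      · refine (hint n).mono (hm.neg.ennreal_ofReal.ennreal_toReal.smul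
          (by fun_prop)).aestronglyMeasurable (.of_forall fun t => ?_)
        rw [norm_smul, norm_mul]
        refine mul_le_mul_of_nonneg_right ?_ (norm_nonneg _)
        rw [Real.norm_eq_abs, Real.norm_eq_abs, ENNReal.toReal_ofReal',
          abs_of_nonneg (le_max_right _ _)]
        exact max_le (neg_le_abs _) (abs_nonneg _)
  rw [withDensity_eq_iff hm.ennreal_ofReal hm.neg.ennreal_ofReal
    hgi.lintegral_lt_top.ne] at heq
  filter_upwards [heq] with t ht
  have h1 : g t = 0 := by
    rcases le_total (g t) 0 with h2 | h2
    · rw [ENNReal.ofReal_of_nonpos h2, eq_comm, ENNReal.ofReal_eq_zero, Pi.neg_apply] at ht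
      linarith
    · rw [ENNReal.ofReal_of_nonpos (p := (-g) t) (by simpa using h2), ENNReal.ofReal_eq_zero] at ht
      linarith
  exact (mul_eq_zero.1 h1).resolve_right (Real.exp_pos _).ne'

lemma isDecayingChain_expPoly (P : ℝ[X]) (m : ℕ) :
    ∃ B, IsDecayingChain B (1 / 4) m fun j => expPoly (expPolyDeriv^[j] P) := by
  choose C hC h using fun j => exists_abs_expPoly_le (expPolyDeriv^[j] P)
  refine ⟨∑ j ∈ Finset.range (m + 1), C j, fun j _ => (continuous_expPoly _).aestronglyMeasurable,
    fun j hj => ?_, fun j hj => ⟨expPoly (expPolyDeriv^[j] P) 0, .of_forall fun t => ?_⟩⟩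
  · filter_upwards [ae_restrict_mem measurableSet_Ioi] with t ht
    refine (h j t (le_of_lt ht)).trans (mul_le_mul_of_nonneg_right ?_ (Real.exp_pos _).le)
    exact Finset.single_le_sum (f := C) (fun i _ => hC i) (Finset.mem_range.2 (by omega))
  · rw [intervalIntegral.integral_eq_sub_of_hasDerivAt (f := expPoly (expPolyDeriv^[j] P))
      (fun s _ => ?_) ((continuous_expPoly _).intervalIntegrable _ _)]
    · ring
    · rw [Function.iterate_succ_apply']
      exact hasDerivAt_expPoly _ _

/-- Eigenfunctions of a symmetric operator with distinct eigenvalues `m + 1/2` and `n + 1/2` are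
orthogonal. The symmetry is `laguerre_symm` applied to the derivatives of a Laguerre function, with
`P = 1`. -/
lemma integral_expPoly_laguerre_mul {m n : ℕ} (hmn : m ≠ n) :
    ∫ t in Ioi 0, expPoly (laguerre m) t * expPoly (laguerre n) t = 0 := by
  obtain ⟨B, hB⟩ := isDecayingChain_expPoly (laguerre m) 2
  have h := hB.laguerre_symm (j := 0) (by norm_num) (by norm_num) 1 n
  rw [← integral_add, ← integral_add] at h
  rotate_left
  · exact (hB.integrable_mul (by norm_num) (by norm_num) _).add
      (hB.integrable_mul (by norm_num) (by norm_num) _)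
  · exact hB.integrable_mul (by norm_num) (by norm_num) _
  · exact hB.integrable_mul (by norm_num) (by norm_num) _
  · exact hB.integrable_mul (by norm_num) (by norm_num) _
  have h2 : ((n : ℝ) + 1 / 2) * ∫ t in Ioi 0, expPoly (laguerre m) t * expPoly (laguerre n) t
      = ((m : ℝ) + 1 / 2) * ∫ t in Ioi 0, expPoly (laguerre m) t * expPoly (laguerre n) t := by
    rw [one_mul] at h
    refine h.trans ?_
    rw [← integral_const_mul]
    refine integral_congr_ae (.of_forall fun t => ?_)
    have h3 := congrArg (fun P => expPoly P t) (laguerre_eigen m)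
    have h4 : expPolyDeriv (Polynomial.X * expPolyDeriv (laguerre m))
        = expPolyDeriv (laguerre m)
          + Polynomial.X * expPolyDeriv (expPolyDeriv (laguerre m)) := by
      rw [expPolyDeriv_mul, Polynomial.derivative_X, one_mul]
    rw [h4] at h3
    simp only [expPoly, Function.iterate_succ, Function.iterate_zero, Function.comp_apply, id,
      Polynomial.eval_mul, Polynomial.eval_sub, Polynomial.eval_add, Polynomial.eval_neg,
      Polynomial.eval_C, Polynomial.eval_X, Polynomial.derivative_X, Polynomial.derivative_one,
      Polynomial.derivative_zero, mul_one, mul_zero, Polynomial.eval_one, Polynomial.eval_zero]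
      at h3 ⊢
    linear_combination (-(laguerre n).eval t * Real.exp (-t / 2)) * h3
  have h5 : (n : ℝ) - m ≠ 0 := sub_ne_zero.2 (by exact_mod_cast hmn.symm)
  exact (mul_eq_zero.1 (show ((n : ℝ) - m) * _ = 0 by linear_combination h2)).resolve_left h5

lemma integral_sq_expPoly_pos {P : ℝ[X]} (hP : P ≠ 0) : 0 < ∫ t in Ioi 0, expPoly P t ^ 2 := by
  have hi := (memLp_two_iff_integrable_sq (continuous_expPoly P).aestronglyMeasurable).1
    (memLp_expPoly P)
  refine (integral_pos_iff_support_of_nonneg (fun t => sq_nonneg _) hi).2 ?_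
  have hs : Ioi 0 \ (P.roots.toFinset : Set ℝ) ⊆ Function.support fun t => expPoly P t ^ 2 := by
    intro t ht
    have h1 : P.eval t ≠ 0 := fun h => ht.2 (by simp [hP, Polynomial.IsRoot, h])
    simp [expPoly, h1]
  refine lt_of_lt_of_le ?_ (measure_mono hs)
  rw [measure_sdiff_null (P.roots.toFinset.finite_toSet.measure_zero _)]
  simp

/-- The normalised Laguerre functions. -/
noncomputable def laguerreFun (n : ℕ) (t : ℝ) : ℝ :=
  (√(∫ s in Ioi 0, expPoly (laguerre n) s ^ 2))⁻¹ * expPoly (laguerre n) t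

lemma continuous_laguerreFun (n : ℕ) : Continuous (laguerreFun n) :=
  continuous_const.mul (continuous_expPoly _)

lemma memLp_laguerreFun (n : ℕ) : MemLp (laguerreFun n) 2 (volume.restrict (Ioi 0)) :=
  (memLp_expPoly _).const_mul _

lemma laguerre_ne_zero (n : ℕ) : laguerre n ≠ 0 := by
  intro h
  have := degree_laguerre n
  simp [h] at this

lemma inner_toLp_two {f g : ℝ → ℝ} {μ : Measure ℝ} (hf : MemLp f 2 μ) (hg : MemLp g 2 μ) :
    inner ℝ (hf.toLp f) (hg.toLp g) = ∫ t, f t * g t ∂μ := by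
  rw [L2.inner_def]
  refine integral_congr_ae ?_
  filter_upwards [hf.coeFn_toLp, hg.coeFn_toLp] with t h1 h2
  rw [h1, h2]
  simp [mul_comm]

lemma orthonormal_laguerreFun :
    Orthonormal ℝ fun n => (memLp_laguerreFun n).toLp (laguerreFun n) := by
  rw [orthonormal_iff_ite]
  intro m n
  rw [inner_toLp_two]
  have h : ∀ t, laguerreFun m t * laguerreFun n t
      = ((√(∫ s in Ioi 0, expPoly (laguerre m) s ^ 2))⁻¹
        * (√(∫ s in Ioi 0, expPoly (laguerre n) s ^ 2))⁻¹)
        * (expPoly (laguerre m) t * expPoly (laguerre n) t) := fun t => by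
    simp only [laguerreFun]
    ring
  simp only [h, integral_const_mul]
  split_ifs with hmn
  · subst hmn
    have hp := integral_sq_expPoly_pos (laguerre_ne_zero m)
    simp only [← sq, inv_pow, Real.sq_sqrt hp.le]
    exact inv_mul_cancel₀ hp.ne'
  · rw [integral_expPoly_laguerre_mul hmn, mul_zero]

lemma span_laguerre : Submodule.span ℝ (range laguerre) = ⊤ :=
  (Polynomial.Sequence.mk laguerre degree_laguerre).span fun i =>
    (Polynomial.leadingCoeff_ne_zero.2 (laguerre_ne_zero i)).isUnit

/-- There is one Laguerre polynomial of each degree, so they span all polynomials, and orthogonality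
extends to every `P(t) e^{-t/2}`. -/
lemma span_laguerreFun_orthogonal :
    (Submodule.span ℝ (range fun n => (memLp_laguerreFun n).toLp (laguerreFun n)))ᗮ = ⊥ := by
  rw [Submodule.eq_bot_iff]
  intro f hf
  rw [Submodule.mem_orthogonal] at hf
  have h0 : ∀ n, ∫ t in Ioi 0, f t * expPoly (laguerre n) t = 0 := by
    intro n
    have h1 := hf _ (Submodule.subset_span ⟨n, rfl⟩)
    simp only at h1
    rw [← Lp.toLp_coeFn f (Lp.memLp f), inner_toLp_two] at h1
    have hp := integral_sq_expPoly_pos (laguerre_ne_zero n)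
    simp only [laguerreFun, mul_assoc, integral_const_mul] at h1
    refine Eq.trans ?_ ((mul_eq_zero.1 h1).resolve_left (inv_ne_zero (Real.sqrt_pos.2 hp).ne'))
    simp only [mul_comm]
  have h1 : ∀ P, ∫ t in Ioi 0, f t * expPoly P t = 0 := by
    intro P
    have hP : P ∈ Submodule.span ℝ (range laguerre) := by
      rw [span_laguerre]
      trivial
    induction hP using Submodule.span_induction with
    | mem x hx =>
      obtain ⟨n, rfl⟩ := hx
      exact h0 n
    | zero => simp [expPoly]
    | add x y _ _ hx hy =>
      simp only [expPoly_add, mul_add]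
      refine (integral_add ((Lp.memLp f).integrable_mul (memLp_expPoly x))
        ((Lp.memLp f).integrable_mul (memLp_expPoly y))).trans ?_
      exact (congrArg₂ (· + ·) hx hy).trans (add_zero 0)
    | smul a x _ hx => rw [Polynomial.smul_eq_C_mul, integral_mul_expPoly_C_mul, hx, mul_zero]
  exact (Lp.eq_zero_iff_ae_eq_zero).2 (ae_eq_zero_of_integral_mul_expPoly (Lp.memLp f) h1)

/-- Parseval's identity for the Laguerre functions. -/
lemma hasSum_integral_mul_laguerreFun {a b : ℝ → ℝ} (ha : MemLp a 2 (volume.restrict (Ioi 0)))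
    (hb : MemLp b 2 (volume.restrict (Ioi 0))) :
    HasSum (fun n => (∫ t in Ioi 0, a t * laguerreFun n t) * ∫ t in Ioi 0, b t * laguerreFun n t)
      (∫ t in Ioi 0, a t * b t) := by
  have h := (HilbertBasis.mkOfOrthogonalEqBot orthonormal_laguerreFun
    span_laguerreFun_orthogonal).hasSum_inner_mul_inner (ha.toLp a) (hb.toLp b)
  simp only [HilbertBasis.coe_mkOfOrthogonalEqBot, inner_toLp_two] at h
  simpa only [mul_comm (b _)] using h

/-- Bessel's inequality for the Laguerre functions. -/
lemma sum_sq_integral_mul_laguerreFun_le {a : ℝ → ℝ} (ha : MemLp a 2 (volume.restrict (Ioi 0)))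
    (s : Finset ℕ) :
    ∑ n ∈ s, (∫ t in Ioi 0, a t * laguerreFun n t) ^ 2 ≤ ∫ t in Ioi 0, a t ^ 2 := by
  have h := hasSum_integral_mul_laguerreFun ha ha
  simp only [← sq] at h
  exact sum_le_hasSum s (fun i _ => sq_nonneg _) h

/-- The Laguerre coefficients of smooth exponentially decaying functions decay rapidly. -/
lemma exists_sum_laguerre_coeff_le (q : ℕ) {δ : ℝ} (hδ : 0 < δ) :
    ∃ C, 0 ≤ C ∧ ∀ B u, IsDecayingChain B δ (2 * q) u → ∀ s : Finset ℕ,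
      ∑ n ∈ s, ((n : ℝ) + 1 / 2) ^ (2 * q) * (∫ t in Ioi 0, u 0 t * laguerreFun n t) ^ 2
        ≤ C * B ^ 2 := by
  obtain ⟨ι, _, j, P, hj, h⟩ := exists_laguerre_pow_representation q
  -- Half of the decay rate pays for the polynomial factors; the other half keeps `v` square
  -- integrable.
  choose D hD hP using fun i => exists_abs_eval_le (P i) (δ := δ / 2) (by linarith)
  refine ⟨(∑ i, D i) ^ 2 * ∫ t in Ioi (0 : ℝ), Real.exp (-(2 * (δ / 2)) * t),
    mul_nonneg (sq_nonneg _) (integral_nonneg fun t => (Real.exp_pos _).le), fun B u hu s => ?_⟩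
  have hm : ∀ i, AEStronglyMeasurable (fun t => u (j i) t * (P i).eval t)
      (volume.restrict (Ioi 0)) := fun i =>
    (hu.meas _ (hj i)).mul (P i).continuous.aestronglyMeasurable
  have hb : ∀ i, ∀ᵐ t ∂volume.restrict (Ioi (0 : ℝ)), |u (j i) t * (P i).eval t|
      ≤ D i * B * Real.exp (-(δ / 2) * t) := by
    intro i
    filter_upwards [hu.bound _ (hj i), ae_restrict_mem measurableSet_Ioi] with t ht h0
    rw [abs_mul]
    calc |u (j i) t| * |(P i).eval t|
        ≤ (B * Real.exp (-δ * t)) * (D i * Real.exp (δ / 2 * t)) :=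
          mul_le_mul ht (hP i t (le_of_lt h0)) (abs_nonneg _) ((abs_nonneg _).trans ht)
      _ = D i * B * (Real.exp (-δ * t) * Real.exp (δ / 2 * t)) := by ring
      _ = D i * B * Real.exp (-(δ / 2) * t) := by
          rw [← Real.exp_add]
          ring_nf
  set v : ℝ → ℝ := fun t => ∑ i, u (j i) t * (P i).eval t with hv
  have hvm : AEStronglyMeasurable v (volume.restrict (Ioi 0)) :=
    Finset.aestronglyMeasurable_fun_sum _ fun i _ => hm i
  have hvb : ∀ᵐ t ∂volume.restrict (Ioi (0 : ℝ)), |v t|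
      ≤ (∑ i, D i) * B * Real.exp (-(δ / 2) * t) := by
    filter_upwards [ae_all_iff.2 hb] with t ht
    rw [Finset.sum_mul, Finset.sum_mul]
    exact (Finset.abs_sum_le_sum_abs _ _).trans (Finset.sum_le_sum fun i _ => ht i)
  have hcoef : ∀ n : ℕ, ((n : ℝ) + 1 / 2) ^ q * ∫ t in Ioi 0, u 0 t * laguerreFun n t
      = ∫ t in Ioi 0, v t * laguerreFun n t := by
    intro n
    have e1 : ∀ w : ℝ → ℝ, ∫ t in Ioi 0, w t * laguerreFun n t
        = (√(∫ s in Ioi 0, expPoly (laguerre n) s ^ 2))⁻¹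
          * ∫ t in Ioi 0, w t * expPoly (laguerre n) t := by
      intro w
      rw [← integral_const_mul]
      refine integral_congr_ae (.of_forall fun t => ?_)
      simp only [laguerreFun]
      ring
    rw [e1, e1, mul_left_comm, h B δ u hδ hu n, ← integral_finsetSum _ fun i _ =>
      hu.integrable_mul hδ (hj i) _]
    congr 1
    refine integral_congr_ae (.of_forall fun t => ?_)
    simp only [hv, Finset.sum_mul, expPoly_mul, mul_assoc]
  calc ∑ n ∈ s, ((n : ℝ) + 1 / 2) ^ (2 * q) * (∫ t in Ioi 0, u 0 t * laguerreFun n t) ^ 2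
      = ∑ n ∈ s, (∫ t in Ioi 0, v t * laguerreFun n t) ^ 2 := by
        refine Finset.sum_congr rfl fun n _ => ?_
        rw [← hcoef, mul_pow, ← pow_mul, mul_comm q 2]
    _ ≤ ∫ t in Ioi 0, v t ^ 2 :=
        sum_sq_integral_mul_laguerreFun_le
          (memLp_two_of_abs_le_exp (half_pos hδ) hvm hvb) s
    _ ≤ ((∑ i, D i) * B) ^ 2 * ∫ t in Ioi (0 : ℝ), Real.exp (-(2 * (δ / 2)) * t) :=
        integral_sq_le_of_abs_le_exp (half_pos hδ) hvm hvb
    _ = _ := by ring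

end LaguerreBasis

/-! ### The factors as Laguerre coefficients along trajectories -/

section LaguerreFactor

variable {d : ℕ} {f : EuclideanSpace ℝ (Fin d) → EuclideanSpace ℝ (Fin d)}
  {Ω : Set (EuclideanSpace ℝ (Fin d))} {w u φ ψ : EuclideanSpace ℝ (Fin d) → ℝ} {M δ : ℝ}

lemma IsSmoothAlongFlow.exists_seq {k : ℕ} (hu : IsSmoothAlongFlow f Ω w k u) :
    ∃ U : ℕ → EuclideanSpace ℝ (Fin d) → ℝ, U 0 = u ∧ (∀ j ≤ k, MemXDual Ω w (U j)) ∧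
      ∀ j < k, HasFlowDerivative f Ω (U j) (U (j + 1)) := by
  induction k generalizing u with
  | zero => exact ⟨fun _ => u, rfl, fun _ _ => hu, by simp⟩
  | succ k ih =>
    obtain ⟨hu, h, huh, hh⟩ := hu
    obtain ⟨U, rfl, h1, h2⟩ := ih hh
    refine ⟨fun j => Nat.casesOn j u U, rfl, fun j hj => ?_, fun j hj => ?_⟩
    · cases j with
      | zero => exact hu
      | succ j => exact h1 j (by omega)
    · cases j with
      | zero => exact huh
      | succ j => exact h2 j (by omega)

lemma exists_ae_prod_abs_comp_flow_le (hadm : IsAdmissible f Ω w)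
    (hM : ∀ t, 0 ≤ t → ∀ᵐ x ∂volume.restrict Ω,
      (w (flow f t x))⁻¹ ≤ M * Real.exp (-δ * t) * (w x)⁻¹) (hM0 : 0 ≤ M)
    (hu : MemXDual Ω w u) :
    ∃ C, 0 ≤ C ∧
      (∀ t, 0 ≤ t → ∀ᵐ x ∂volume.restrict Ω,
        |u (flow f t x)| ≤ C * (w x)⁻¹ * Real.exp (-δ * t)) ∧
      ∀ᵐ p ∂(volume.restrict Ω).prod (volume.restrict (Ioi (0 : ℝ))),
        |u (flow f p.2 p.1)| ≤ C * (w p.1)⁻¹ * Real.exp (-δ * p.2) := by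
  obtain ⟨C, hC, h⟩ := exists_abs_comp_flow_le hadm hM hu
  exact ⟨C * M, mul_nonneg hC hM0, h,
    ae_prod_abs_comp_flow_le hadm (aemeasurable_of_memXDual hadm hu) h⟩

/-- The dependence on the starting point is exactly `w(x)⁻¹`, which the weight `w²` of `H` later
cancels. -/
lemma exists_ae_isDecayingChain (hadm : IsAdmissible f Ω w)
    (hM : ∀ t, 0 ≤ t → ∀ᵐ x ∂volume.restrict Ω,
      (w (flow f t x))⁻¹ ≤ M * Real.exp (-δ * t) * (w x)⁻¹) (hM0 : 0 ≤ M) {k : ℕ}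
    {U : ℕ → EuclideanSpace ℝ (Fin d) → ℝ} (hU : ∀ j ≤ k, MemXDual Ω w (U j))
    (hd : ∀ j < k, HasFlowDerivative f Ω (U j) (U (j + 1))) :
    ∃ C, ∀ᵐ x ∂volume.restrict Ω,
      IsDecayingChain (C * (w x)⁻¹) δ k fun j t => U j (flow f t x) := by
  have h1 : ∀ j : Fin (k + 1), MemXDual Ω w (U j) := fun j => hU j (by omega)
  choose C hC _ hCp using fun j => exists_ae_prod_abs_comp_flow_le hadm hM hM0 (h1 j)
  refine ⟨∑ j, C j, ?_⟩
  have hmeas : ∀ᵐ x ∂volume.restrict Ω, ∀ j : Fin (k + 1),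
      AEStronglyMeasurable (fun t => U j (flow f t x)) (volume.restrict (Ioi 0)) :=
    ae_all_iff.2 fun j => (hadm.aemeasurable_comp_flow_prod
      (aemeasurable_of_memXDual hadm (h1 j))).aestronglyMeasurable.prodMk_left
  have hbound : ∀ᵐ x ∂volume.restrict Ω, ∀ j : Fin (k + 1),
      ∀ᵐ t ∂volume.restrict (Ioi (0 : ℝ)),
        |U j (flow f t x)| ≤ C j * (w x)⁻¹ * Real.exp (-δ * t) :=
    ae_all_iff.2 fun j => Measure.ae_ae_of_ae_prod (hCp j)
  have hprim : ∀ᵐ x ∂volume.restrict Ω, ∀ j : Fin k, ∀ᵐ t ∂volume.restrict (Ioi (0 : ℝ)),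
      U j (flow f t x) = U j x + ∫ τ in 0..t, U (j + 1) (flow f τ x) :=
    ae_all_iff.2 fun j => (hd j j.2).ae_ae hadm.isOpen hadm.boundary hadm.dynamics
      hadm.isBounded hadm.invariant
  filter_upwards [hmeas, hbound, hprim, hadm.weight_pos] with x h2 h3 h4 hw
  refine ⟨fun j hj => h2 ⟨j, by omega⟩, fun j hj => ?_, fun j hj => ⟨_, h4 ⟨j, hj⟩⟩⟩
  filter_upwards [h3 ⟨j, by omega⟩] with t ht
  refine ht.trans ?_
  gcongr
  exact Finset.single_le_sum (f := C) (fun i _ => hC i) (Finset.mem_univ _)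

/-- The Laguerre coefficients of `t ↦ u(Φᵗ(x))`. -/
noncomputable def laguerreFactor (f : EuclideanSpace ℝ (Fin d) → EuclideanSpace ℝ (Fin d))
    (u : EuclideanSpace ℝ (Fin d) → ℝ) (n : ℕ) (x : EuclideanSpace ℝ (Fin d)) : ℝ :=
  ∫ t in Ioi 0, u (flow f t x) * laguerreFun n t

lemma exists_ae_sum_sq_laguerreFactor_le (hadm : IsAdmissible f Ω w)
    (hst : ExponentiallyStable f Ω w) (q : ℕ) (hu : IsSmoothAlongFlow f Ω w (2 * q) u) :
    ∃ C, 0 ≤ C ∧ ∀ᵐ x ∂volume.restrict Ω, ∀ s : Finset ℕ,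
      ∑ n ∈ s, ((n : ℝ) + 1 / 2) ^ (2 * q) * laguerreFactor f u n x ^ 2 ≤ C * (w x)⁻¹ ^ 2 := by
  obtain ⟨M, δ, hM0, hδ, hM⟩ := exists_inv_weight_flow_le hadm hst
  obtain ⟨U, rfl, hU, hd⟩ := hu.exists_seq
  obtain ⟨C, hC⟩ := exists_ae_isDecayingChain hadm hM hM0 hU hd
  obtain ⟨D, hD, h⟩ := exists_sum_laguerre_coeff_le q hδ
  refine ⟨D * C ^ 2, by positivity, ?_⟩
  filter_upwards [hC] with x hx s
  rw [mul_assoc, ← mul_pow]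
  exact h _ _ hx s

lemma aestronglyMeasurable_comp_flow_mul_laguerreFun (hadm : IsAdmissible f Ω w)
    (hu : MemXDual Ω w u) (n : ℕ) :
    AEStronglyMeasurable
      (fun p : EuclideanSpace ℝ (Fin d) × ℝ => u (flow f p.2 p.1) * laguerreFun n p.2)
      ((volume.restrict Ω).prod (volume.restrict (Ioi 0))) :=
  (hadm.aemeasurable_comp_flow_prod (aemeasurable_of_memXDual hadm hu)).aestronglyMeasurable.mul
    ((continuous_laguerreFun n).comp continuous_snd).aestronglyMeasurable

lemma aemeasurable_laguerreFactor (hadm : IsAdmissible f Ω w) (hu : MemXDual Ω w u) (n : ℕ) :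
    AEMeasurable (laguerreFactor f u n) (volume.restrict Ω) :=
  (aestronglyMeasurable_comp_flow_mul_laguerreFun hadm hu n).integral_prod_right'.aemeasurable

/-- A single term of the pointwise Bessel bound with `q = 0`, where no smoothness is required. -/
lemma memXDual_laguerreFactor (hadm : IsAdmissible f Ω w) (hst : ExponentiallyStable f Ω w)
    (hu : MemXDual Ω w u) (n : ℕ) : MemXDual Ω w (laguerreFactor f u n) := by
  obtain ⟨C, hC, h⟩ := exists_ae_sum_sq_laguerreFactor_le hadm hst 0 (u := u) hu
  refine memXDual_of_abs_le hadm (C := √C) (aemeasurable_laguerreFactor hadm hu n) ?_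
  filter_upwards [h, hadm.weight_pos] with x hx hw
  have h1 := hx {n}
  simp only [mul_zero, pow_zero, one_mul, Finset.sum_singleton] at h1
  have h2 := Real.abs_le_sqrt h1
  rwa [Real.sqrt_mul hC, Real.sqrt_sq (inv_pos.2 hw).le] at h2

lemma integrable_sq_mul_weight_sq (hadm : IsAdmissible f Ω w) (hu : MemXDual Ω w u) :
    Integrable (fun x => |u x| ^ 2 * w x ^ 2) (volume.restrict Ω) := by
  have hfin : IsFiniteMeasure (volume.restrict Ω) :=
    ⟨by simpa using hadm.isBounded.measure_lt_top⟩
  have h : MemLp (fun x => u x * w x) 2 (volume.restrict Ω) := MemLp.mono_exponent hu le_top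
  refine ((memLp_two_iff_integrable_sq h.1).1 h).congr (.of_forall fun x => ?_)
  simp only [sq_abs, mul_pow]

/-- The pointwise bound `C w⁻²` times `w²` is the constant `C`, integrable because `Ω` has finite
measure. -/
lemma exists_sum_normHSq_laguerreFactor_le (hadm : IsAdmissible f Ω w)
    (hst : ExponentiallyStable f Ω w) (q : ℕ) (huw : MemXDual Ω w u)
    (hu : IsSmoothAlongFlow f Ω w (2 * q) u) :
    ∃ C, ∀ s : Finset ℕ,
      ∑ n ∈ s, ((n : ℝ) + 1 / 2) ^ (2 * q) * normHSq Ω w (laguerreFactor f u n) ≤ C := by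
  have hfin : IsFiniteMeasure (volume.restrict Ω) :=
    ⟨by simpa using hadm.isBounded.measure_lt_top⟩
  obtain ⟨C, hC, h⟩ := exists_ae_sum_sq_laguerreFactor_le hadm hst q hu
  have hi := fun n => integrable_sq_mul_weight_sq hadm (memXDual_laguerreFactor hadm hst huw n)
  refine ⟨∫ x in Ω, C, fun s => ?_⟩
  simp only [normHSq, ← integral_const_mul]
  rw [← integral_finsetSum _ fun n _ => (hi n).const_mul _]
  refine integral_mono_ae (integrable_finsetSum _ fun n _ => (hi n).const_mul _)
    (integrable_const _) ?_
  filter_upwards [h, hadm.weight_pos] with x hx hw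
  calc ∑ n ∈ s, ((n : ℝ) + 1 / 2) ^ (2 * q) * (|laguerreFactor f u n x| ^ 2 * w x ^ 2)
      = (∑ n ∈ s, ((n : ℝ) + 1 / 2) ^ (2 * q) * laguerreFactor f u n x ^ 2) * w x ^ 2 := by
        rw [Finset.sum_mul]
        simp only [sq_abs, mul_assoc]
    _ ≤ C * (w x)⁻¹ ^ 2 * w x ^ 2 := mul_le_mul_of_nonneg_right (hx s) (sq_nonneg _)
    _ = C := by
        field_simp

lemma aemeasurable_of_memX (hadm : IsAdmissible f Ω w) (hφ : MemX Ω w φ) :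
    AEMeasurable φ (volume.restrict Ω) := by
  refine (hφ.1.aemeasurable.mul hadm.weight_measurable.inv).congr ?_
  filter_upwards [hadm.weight_pos] with x hx
  simp [hx.ne']

/-- `t ↦ ⟨φ, u ∘ Φᵗ⟩` decays exponentially. -/
lemma exists_abs_pairing_comp_flow_le (hadm : IsAdmissible f Ω w)
    (hM : ∀ t, 0 ≤ t → ∀ᵐ x ∂volume.restrict Ω,
      (w (flow f t x))⁻¹ ≤ M * Real.exp (-δ * t) * (w x)⁻¹) (hM0 : 0 ≤ M)
    (hu : MemXDual Ω w u) (hφ : MemX Ω w φ) :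
    ∃ C, ∀ t, 0 ≤ t →
      |pairing Ω w φ (compositionSemigroup f t u)| ≤ C * Real.exp (-δ * t) := by
  obtain ⟨C, hC, h, _⟩ := exists_ae_prod_abs_comp_flow_le hadm hM hM0 hu
  refine ⟨(∫ x in Ω, |φ x * w x|) * C, fun t ht => ?_⟩
  rw [mul_assoc, ← integral_mul_const]
  rw [← Real.norm_eq_abs, pairing]
  refine norm_integral_le_of_norm_le (hφ.abs.mul_const _) ?_
  filter_upwards [h t ht, hadm.weight_pos] with x hx hw
  simp only [compositionSemigroup, Real.norm_eq_abs, abs_mul, abs_pow, abs_of_pos hw]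
  calc |φ x| * |u (flow f t x)| * w x ^ 2
      ≤ |φ x| * (C * (w x)⁻¹ * Real.exp (-δ * t)) * w x ^ 2 := by gcongr
    _ = |φ x| * w x * (C * Real.exp (-δ * t)) := by
        field_simp

lemma aestronglyMeasurable_pairing_comp_flow (hadm : IsAdmissible f Ω w) (hu : MemXDual Ω w u)
    (hφ : MemX Ω w φ) :
    AEStronglyMeasurable (fun t => pairing Ω w φ (compositionSemigroup f t u))
      (volume.restrict (Ioi 0)) := by
  have h : AEMeasurable (fun p : EuclideanSpace ℝ (Fin d) × ℝ =>
      φ p.1 * u (flow f p.2 p.1) * w p.1 ^ 2)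
      ((volume.restrict Ω).prod (volume.restrict (Ioi 0))) :=
    ((aemeasurable_of_memX hadm hφ).comp_fst.mul
      (hadm.aemeasurable_comp_flow_prod (aemeasurable_of_memXDual hadm hu))).mul
      (hadm.weight_measurable.pow_const 2).comp_fst
  exact h.aestronglyMeasurable.prod_swap.integral_prod_right'

lemma memLp_pairing_comp_flow (hadm : IsAdmissible f Ω w) (hst : ExponentiallyStable f Ω w)
    (hu : MemXDual Ω w u) (hφ : MemX Ω w φ) :
    MemLp (fun t => pairing Ω w φ (compositionSemigroup f t u)) 2 (volume.restrict (Ioi 0)) := by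
  obtain ⟨M, δ, hM0, hδ, hM⟩ := exists_inv_weight_flow_le hadm hst
  obtain ⟨C, hC⟩ := exists_abs_pairing_comp_flow_le hadm hM hM0 hu hφ
  refine memLp_two_of_abs_le_exp (B := C) hδ (aestronglyMeasurable_pairing_comp_flow hadm hu hφ) ?_
  filter_upwards [ae_restrict_mem measurableSet_Ioi] with t ht
  exact hC t (le_of_lt ht)

/-- Fubini; the integrand is dominated by the product of `|φ w|`, integrable on `Ω`, and `C e^{-δt}
|ℓₙ(t)|`, integrable in time. -/
lemma pairing_laguerreFactor (hadm : IsAdmissible f Ω w) (hst : ExponentiallyStable f Ω w)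
    (hu : MemXDual Ω w u) (hφ : MemX Ω w φ) (n : ℕ) :
    pairing Ω w φ (laguerreFactor f u n)
      = ∫ t in Ioi 0, pairing Ω w φ (compositionSemigroup f t u) * laguerreFun n t := by
  obtain ⟨M, δ, hM0, hδ, hM⟩ := exists_inv_weight_flow_le hadm hst
  obtain ⟨C, hC, -, h⟩ := exists_ae_prod_abs_comp_flow_le hadm hM hM0 hu
  have hE : Integrable (fun t => C * (Real.exp (-δ * t) * |laguerreFun n t|))
      (volume.restrict (Ioi 0)) := by
    refine Integrable.const_mul (MemLp.integrable_mul (p := 2) (q := 2) ?_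
      (memLp_laguerreFun n).abs) C
    refine memLp_two_of_abs_le_exp (B := 1) hδ (by fun_prop) (.of_forall fun t => ?_)
    rw [abs_of_pos (Real.exp_pos _), one_mul]
  have hint : Integrable (fun p : EuclideanSpace ℝ (Fin d) × ℝ =>
      φ p.1 * w p.1 ^ 2 * (u (flow f p.2 p.1) * laguerreFun n p.2))
      ((volume.restrict Ω).prod (volume.restrict (Ioi 0))) := by
    refine (Integrable.mul_prod hφ.abs hE).mono' ?_ ?_
    · exact ((aemeasurable_of_memX hadm hφ).mul
        (hadm.weight_measurable.pow_const 2)).comp_fst.aestronglyMeasurable.mul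
        (aestronglyMeasurable_comp_flow_mul_laguerreFun hadm hu n)
    · filter_upwards [h, Measure.quasiMeasurePreserving_fst.ae hadm.weight_pos] with p hp hw
      simp only [Real.norm_eq_abs, abs_mul, abs_pow, abs_of_pos hw]
      calc |φ p.1| * w p.1 ^ 2 * (|u (flow f p.2 p.1)| * |laguerreFun n p.2|)
          ≤ |φ p.1| * w p.1 ^ 2
            * (C * (w p.1)⁻¹ * Real.exp (-δ * p.2) * |laguerreFun n p.2|) := by gcongr
        _ = |φ p.1| * w p.1 * (C * (Real.exp (-δ * p.2) * |laguerreFun n p.2|)) := by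
            field_simp
  have h1 := integral_integral_swap
    (f := fun x t => φ x * w x ^ 2 * (u (flow f t x) * laguerreFun n t)) hint
  calc pairing Ω w φ (laguerreFactor f u n)
      = ∫ x in Ω, ∫ t in Ioi 0, φ x * w x ^ 2 * (u (flow f t x) * laguerreFun n t) := by
        refine integral_congr_ae (.of_forall fun x => ?_)
        simp only [laguerreFactor, integral_const_mul]
        ring
    _ = _ := by
        rw [h1]
        refine integral_congr_ae (.of_forall fun t => ?_)
        simp only [pairing, compositionSemigroup, ← integral_mul_const]
        refine integral_congr_ae (.of_forall fun x => ?_)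
        ring

lemma hasSum_pairing_laguerreFactor (hadm : IsAdmissible f Ω w)
    (hst : ExponentiallyStable f Ω w) (hu : MemXDual Ω w u) (hφ : MemX Ω w φ) (hψ : MemX Ω w ψ) :
    HasSum (fun n => pairing Ω w φ (laguerreFactor f u n) * pairing Ω w ψ (laguerreFactor f u n))
      (∫ t in Ioi 0, pairing Ω w φ (compositionSemigroup f t u)
        * pairing Ω w ψ (compositionSemigroup f t u)) := by
  simp only [pairing_laguerreFactor hadm hst hu hφ, pairing_laguerreFactor hadm hst hu hψ]
  exact hasSum_integral_mul_laguerreFun (memLp_pairing_comp_flow hadm hst hu hφ)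
    (memLp_pairing_comp_flow hadm hst hu hψ)

lemma valueIntegrand_eq_sum (hadm : IsAdmissible f Ω w) {c : ℕ → EuclideanSpace ℝ (Fin d) → ℝ}
    (hc : ∀ i, MemXDual Ω w (c i)) {r : ℕ} (hr : ∀ i, r < i → c i =ᵐ[volume.restrict Ω] 0)
    (hφ : MemX Ω w φ) (hψ : MemX Ω w ψ) {t : ℝ} (ht : 0 ≤ t) :
    valueIntegrand f Ω w c φ ψ t = ∑ i : Fin (r + 1),
      pairing Ω w φ (compositionSemigroup f t (c i))
        * pairing Ω w ψ (compositionSemigroup f t (c i)) := by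
  have h1 := isPreadjointValue_preadjoint hadm ht hφ
  have h2 := isPreadjointValue_preadjoint hadm ht hψ
  rw [valueIntegrand, tsum_eq_sum (s := Finset.range (r + 1)), Finset.sum_range]
  · simp only [observation, h1.2 _ (hc _), h2.2 _ (hc _)]
  · intro i hi
    have h0 : observation Ω w c (preadjoint f Ω w t φ) i = 0 := by
      refine integral_eq_zero_of_ae ?_
      filter_upwards [hr i (by simpa using hi)] with x hx
      simp [hx]
    rw [h0, zero_mul]

lemma integrable_pairing_mul_pairing (hadm : IsAdmissible f Ω w)
    (hst : ExponentiallyStable f Ω w) (hu : MemXDual Ω w u) (hφ : MemX Ω w φ) (hψ : MemX Ω w ψ) :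
    Integrable (fun t => pairing Ω w φ (compositionSemigroup f t u)
        * pairing Ω w ψ (compositionSemigroup f t u)) (volume.restrict (Ioi 0)) :=
  (memLp_pairing_comp_flow hadm hst hu hφ).integrable_mul
    (memLp_pairing_comp_flow hadm hst hu hψ)

end LaguerreFactor

/-! ### Interleaving finitely many sequences, and tails of series -/

section Series

lemma hasSum_prod_fintype {ι : Type*} [Fintype ι] {F : ℕ × ι → ℝ} {S : ι → ℝ}
    (h : ∀ i, HasSum (fun n => F (n, i)) (S i)) : HasSum F (∑ i, S i) := by
  classical
  have h1 : ∀ i, HasSum (fun k : ℕ × ι => if k.2 = i then F k else 0) (S i) := by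
    intro i
    have hinj : Function.Injective fun n : ℕ => (n, i) := fun m n hmn => congrArg Prod.fst hmn
    refine (hinj.hasSum_iff fun k hk => ?_).1 ((h i).congr_fun fun n => ?_)
    · rw [if_neg]
      rintro rfl
      exact hk ⟨k.1, rfl⟩
    · simp
  have h2 := hasSum_sum fun i (_ : i ∈ Finset.univ) => h1 i
  simpa using h2

lemma exists_sum_pow_mul_divModEquiv_le {r m : ℕ} {a : ℕ × Fin (r + 1) → ℝ}
    (h : ∀ i, ∃ C, ∀ s : Finset ℕ, ∑ n ∈ s, ((n : ℝ) + 1 / 2) ^ m * a (n, i) ≤ C)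
    (ha : ∀ k, 0 ≤ a k) :
    ∃ C, ∀ s : Finset ℕ, ∑ k ∈ s, (k : ℝ) ^ m * a (Nat.divModEquiv (r + 1) k) ≤ C := by
  choose C hC using h
  set e := Nat.divModEquiv (r + 1) with he
  refine ⟨(2 * ((r : ℝ) + 1)) ^ m * ∑ i, C i, fun s => ?_⟩
  -- Interleaving slows the index by the number `r + 1` of sequences; the factor `2` lets the shift
  -- `1/2` cover the remainder of the division.
  have h1 : ∀ k : ℕ, (k : ℝ) ≤ 2 * ((r : ℝ) + 1) * (((e k).1 : ℝ) + 1 / 2) := by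
    intro k
    have h2 : (e k).1 = k / (r + 1) := rfl
    have h3 : k ≤ (r + 1) * (k / (r + 1)) + r := by
      have := Nat.div_add_mod k (r + 1)
      have := Nat.mod_lt k (show 0 < r + 1 by omega)
      omega
    have h4 : (k : ℝ) ≤ ((r : ℝ) + 1) * ((k / (r + 1) : ℕ) : ℝ) + r := by exact_mod_cast h3
    have h5 : 0 ≤ ((r : ℝ) + 1) * ((k / (r + 1) : ℕ) : ℝ) := by positivity
    rw [h2]
    linarith
  calc ∑ k ∈ s, (k : ℝ) ^ m * a (e k)
      ≤ ∑ k ∈ s, (2 * ((r : ℝ) + 1)) ^ m * ((((e k).1 : ℝ) + 1 / 2) ^ m * a (e k)) := by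
        refine Finset.sum_le_sum fun k _ => ?_
        rw [← mul_assoc, ← mul_pow]
        exact mul_le_mul_of_nonneg_right (pow_le_pow_left₀ (Nat.cast_nonneg k) (h1 k) m) (ha _)
    _ = (2 * ((r : ℝ) + 1)) ^ m * ∑ k ∈ s.map e.toEmbedding, ((k.1 : ℝ) + 1 / 2) ^ m * a k := by
        rw [Finset.mul_sum, Finset.sum_map]
        rfl
    _ ≤ (2 * ((r : ℝ) + 1)) ^ m * ∑ k ∈ (s.image fun k => (e k).1) ×ˢ Finset.univ,
          ((k.1 : ℝ) + 1 / 2) ^ m * a k := by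
        refine mul_le_mul_of_nonneg_left (Finset.sum_le_sum_of_subset_of_nonneg ?_ ?_)
          (by positivity)
        · intro k hk
          obtain ⟨n, hn, rfl⟩ := Finset.mem_map.1 hk
          exact Finset.mem_product.2 ⟨Finset.mem_image_of_mem _ hn, Finset.mem_univ _⟩
        · exact fun k _ _ => mul_nonneg (by positivity) (ha k)
    _ ≤ (2 * ((r : ℝ) + 1)) ^ m * ∑ i, C i := by
        rw [Finset.sum_product_right]
        exact mul_le_mul_of_nonneg_left (Finset.sum_le_sum fun i _ => hC i _) (by positivity)

/-- A Markov-type estimate: on the tail each term may be multiplied by `(k / N)^m ≥ 1`. -/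
lemma isBigO_tsum_tail {a : ℕ → ℝ} {m : ℕ} {C : ℝ} (ha : ∀ k, 0 ≤ a k) (hs : Summable a)
    (h : ∀ s : Finset ℕ, ∑ k ∈ s, (k : ℝ) ^ m * a k ≤ C) :
    (fun N => ∑' i, a (N + i)) =O[atTop] fun N : ℕ => (N : ℝ) ^ (-(m : ℤ)) := by
  refine IsBigO.of_bound C ?_
  filter_upwards [eventually_gt_atTop 0] with N hN
  have hN0 : (0 : ℝ) < N := by exact_mod_cast hN
  rw [Real.norm_of_nonneg (tsum_nonneg fun i => ha _), Real.norm_of_nonneg (by positivity),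
    zpow_neg, zpow_natCast, ← div_eq_mul_inv]
  refine (hs.comp_injective (add_right_injective N)).tsum_le_of_sum_le fun s => ?_
  rw [le_div_iff₀ (by positivity), Finset.sum_mul]
  calc ∑ i ∈ s, a (N + i) * (N : ℝ) ^ m
      ≤ ∑ i ∈ s, ((N + i : ℕ) : ℝ) ^ m * a (N + i) := by
        refine Finset.sum_le_sum fun i _ => ?_
        rw [mul_comm]
        refine mul_le_mul_of_nonneg_right (pow_le_pow_left₀ hN0.le ?_ m) (ha _)
        exact_mod_cast Nat.le_add_right N i
    _ = ∑ k ∈ s.map (addLeftEmbedding N), (k : ℝ) ^ m * a k := by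
        rw [Finset.sum_map]
        rfl
    _ ≤ C := h _

end Series

end KoopmanLyapunov

/-! ### The main theorem -/

theorem mainTheorem7 {d : ℕ}
    (f : EuclideanSpace ℝ (Fin d) → EuclideanSpace ℝ (Fin d))
    (Ω : Set (EuclideanSpace ℝ (Fin d))) (w : EuclideanSpace ℝ (Fin d) → ℝ)
    (hadm : KoopmanLyapunov.IsAdmissible f Ω w)
    (hstable : KoopmanLyapunov.ExponentiallyStable f Ω w)
    (c : ℕ → EuclideanSpace ℝ (Fin d) → ℝ)
    (hc : ∀ i, KoopmanLyapunov.MemXDual Ω w (c i))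
    (r : ℕ) (hr : ∀ i, r < i → c i =ᵐ[volume.restrict Ω] 0) :
    ∃ p : ℕ → EuclideanSpace ℝ (Fin d) → ℝ,
      (∀ i, KoopmanLyapunov.MemXDual Ω w (p i)) ∧
      (Summable fun i => KoopmanLyapunov.normHSq Ω w (p i)) ∧
      (∀ φ ψ, KoopmanLyapunov.MemX Ω w φ → KoopmanLyapunov.MemX Ω w ψ →
        IntegrableOn (KoopmanLyapunov.valueIntegrand f Ω w c φ ψ) (Ioi 0) volume ∧
        HasSum
          (fun i => KoopmanLyapunov.pairing Ω w φ (p i) * KoopmanLyapunov.pairing Ω w ψ (p i))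
          (KoopmanLyapunov.valueForm f Ω w c φ ψ)) ∧
      (∀ m : ℕ, 0 < m → Even m →
        (∀ j, KoopmanLyapunov.MemSobolevInfty Ω (m - 1) (fun x => f x j)) →
        (∀ i, KoopmanLyapunov.MemSobolevInfty Ω m (c i)) →
        (KoopmanLyapunov.tail Ω w p) =O[atTop] fun N : ℕ => (N : ℝ) ^ (-(m : ℤ))) ∧
      ((∀ k : ℕ, (∀ j, KoopmanLyapunov.MemSobolevInfty Ω k (fun x => f x j)) ∧
          ∀ i, KoopmanLyapunov.MemSobolevInfty Ω k (c i)) →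
        ∀ m : ℕ, (KoopmanLyapunov.tail Ω w p) =O[atTop] fun N : ℕ => (N : ℝ) ^ (-(m : ℤ))) := by
  -- Index `k = n(r + 1) + i` carries the `n`-th Laguerre coefficient of `cᵢ`. The definition does
  -- not involve `m`, so one sequence serves all decay rates at once.
  set e := Nat.divModEquiv (r + 1) with he
  set F : ℕ × Fin (r + 1) → EuclideanSpace ℝ (Fin d) → ℝ :=
    fun k => KoopmanLyapunov.laguerreFactor f (c k.2) k.1 with hF
  have hnonneg : ∀ k, 0 ≤ KoopmanLyapunov.normHSq Ω w (F k) := fun k =>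
    integral_nonneg fun x => by positivity
  have hrate : ∀ q, (∀ i, KoopmanLyapunov.IsSmoothAlongFlow f Ω w (2 * q) (c i)) →
      ∃ C, ∀ s : Finset ℕ,
        ∑ k ∈ s, (k : ℝ) ^ (2 * q) * KoopmanLyapunov.normHSq Ω w (F (e k)) ≤ C :=
    fun q hq => KoopmanLyapunov.exists_sum_pow_mul_divModEquiv_le
      (fun i => KoopmanLyapunov.exists_sum_normHSq_laguerreFactor_le hadm hstable q (hc i) (hq i))
      hnonneg
  -- The case `q = 0` of the rate, where smoothness along the flow means just `cᵢ ∈ X*`.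
  have hsum : Summable fun k => KoopmanLyapunov.normHSq Ω w (F (e k)) := by
    obtain ⟨C, hC⟩ := hrate 0 hc
    exact summable_of_sum_le (fun k => hnonneg _) fun s => by simpa using hC s
  have hdecay : ∀ q, (∀ j, KoopmanLyapunov.MemSobolevInfty Ω (2 * q - 1) (fun x => f x j)) →
      (∀ i, KoopmanLyapunov.MemSobolevInfty Ω (2 * q) (c i)) →
      (KoopmanLyapunov.tail Ω w fun k => F (e k)) =O[atTop]
        fun N : ℕ => (N : ℝ) ^ (-((2 * q : ℕ) : ℤ)) := by
    intro q hf hcq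
    obtain ⟨C, hC⟩ := hrate q fun i =>
      KoopmanLyapunov.isSmoothAlongFlow_of_memSobolevInfty hadm hf (hcq i) (hc i)
    exact KoopmanLyapunov.isBigO_tsum_tail (fun k => hnonneg _) hsum hC
  refine ⟨fun k => F (e k), fun k => KoopmanLyapunov.memXDual_laguerreFactor hadm hstable (hc _) _,
    hsum, fun φ ψ hφ hψ => ?_, fun m _ hm hf hcm => ?_, fun h m => ?_⟩
  · have hval : KoopmanLyapunov.valueIntegrand f Ω w c φ ψ =ᵐ[volume.restrict (Ioi 0)]
        fun t => ∑ i : Fin (r + 1),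
          KoopmanLyapunov.pairing Ω w φ (KoopmanLyapunov.compositionSemigroup f t (c i))
            * KoopmanLyapunov.pairing Ω w ψ (KoopmanLyapunov.compositionSemigroup f t (c i)) := by
      filter_upwards [ae_restrict_mem measurableSet_Ioi] with t ht
      exact KoopmanLyapunov.valueIntegrand_eq_sum hadm hc hr hφ hψ (le_of_lt ht)
    have hint := fun i : Fin (r + 1) =>
      KoopmanLyapunov.integrable_pairing_mul_pairing hadm hstable (hc i) hφ hψ
    refine ⟨(integrable_congr hval).2 (integrable_finsetSum _ fun i _ => hint i), ?_⟩
    rw [KoopmanLyapunov.valueForm, integral_congr_ae hval,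
      integral_finsetSum _ fun i _ => hint i]
    have hpar := KoopmanLyapunov.hasSum_prod_fintype
      (F := fun k => KoopmanLyapunov.pairing Ω w φ (F k) * KoopmanLyapunov.pairing Ω w ψ (F k))
      fun i => KoopmanLyapunov.hasSum_pairing_laguerreFactor (u := c i) hadm hstable (hc i) hφ hψ
    exact (Equiv.hasSum_iff e).2 hpar
  · obtain ⟨q, rfl⟩ := hm.two_dvd
    exact hdecay q hf hcm
  -- With all orders available, `q = m` gives the even rate `N^{-2m}`, which is stronger than
  -- `N^{-m}`.
  · refine (hdecay m (h _).1 (h _).2).trans (IsBigO.of_bound 1 ?_)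
    filter_upwards [eventually_ge_atTop 1] with N hN
    have hN1 : (1 : ℝ) ≤ N := by exact_mod_cast hN
    rw [one_mul, norm_zpow, norm_zpow, Real.norm_of_nonneg (zero_le_one.trans hN1)]
    exact zpow_le_zpow_right₀ hN1 (by push_cast; omega)
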